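/- Let $\Lambda$ be the $\mathbb{Q}$-algebra of symmetric functions in countably many variables $x_1,x_2,\dots$, with complete homogeneous symmetric functions $h_k$ (where $h_k=0$ for $k<0$), monomial symmetric functions $m_\lambda$, and $h_\lambda=h_{\lambda_1}h_{\lambda_2}\cdots$. Let $\langle\cdot,\cdot\rangle$ be the Hall inner product, for which $\langle h_\lambda,m_\mu\rangle=\delta_{\lambda\mu}$. For an integer $t\ge 2$ let $\varphi_t:\Lambda\to\Lambda$ be the $t$-th Verschiebung operator, i.e. the adjoint of the plethysm $f\mapsto f\circ p_t=f(x_1^t,x_2^t,\dots)$: $\langle f\circ p_t,g\rangle=\langle f,\varphi_t g\rangle$ for all $f,g\in\Lambda$. For partitions $\mu\subseteq\lambda$ the skew Schur function is $s_{\lambda/\mu}=\det_{1\le i,j\le l(\lambda)}\big(h_{\lambda_i-\mu_j-i+j}\big)$, where $l(\lambda)$ is the number of nonzero parts of $\lambda$. A $t$-ribbon is an edge-connected skew shape with $t$ cells and no $2\times2$ square; its height $\mathrm{ht}$ is one less than the number of rows it occupies. The skew shape $\lambda/\mu$ is $t$-tileable if there are partitions $\mu=\nu^{(0)}\subseteq\nu^{(1)}\subseteq\cdots\subseteq\nu^{(m)}=\lambda$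 such that each $\nu^{(r)}/\nu^{(r-1)}$ is a $t$-ribbon; in that case $\mathrm{sgn}_t(\lambda/\mu)=(-1)^{\sum_{r=1}^m \mathrm{ht}(\nu^{(r)}/\nu^{(r-1)})}$, which does not depend on the choice of the sequence. For $0\le r\le t-1$ let $\lambda^{(r)}$ denote the $r$-th component of Littlewood's $t$-quotient of $\lambda$: the partition whose parts are obtained by running through the elements $b$ of $\{\lambda_i-i : i\ge1\}$ with $b\equiv r \pmod t$ in decreasing order and recording, for each, the number of integers $e<b$ with $e\equiv r\pmod t$ and $e\notin\{\lambda_i-i : i\ge 1\}$. **Theorem.** Let $t\ge2$ be an integer and $\lambda/\mu$ a skew shape (that is, $\mu\subseteq\lambda$). If $\lambda/\mu$ is not $t$-tileable, then $\varphi_t s_{\lambda/\mu}=0$. If $\lambda/\mu$ is $t$-tileable, then $$\varphi_t s_{\lambda/\mu}=\mathrm{sgn}_t(\lambda/\mu)\prod_{r=0}^{t-1}s_{\lambda^{(r)}/\mu^{(r)}},$$ and this holds with $\mathrm{sgn}_t(\lambda/\mu)$ computed from any sequence $\nu^{(0)},\dots,\nu^{(m)}$ as above. -/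

import Mathlib

noncomputable section

namespace SymFun

/-- The `ℚ`-algebra `Λ` of symmetric functions in the countable alphabet `x₀, x₁, x₂, …`: the formal
power series over `ℚ` that are invariant under all permutations of the variables and have bounded
degree. -/
def Lambda : Subalgebra ℚ (MvPowerSeries ℕ ℚ) where
  carrier := {f | (∀ σ : Equiv.Perm ℕ, MvPowerSeries.renameEquiv ℚ σ f = f) ∧
    ∃ N : ℕ, ∀ d : ℕ →₀ ℕ, N < d.degree → MvPowerSeries.coeff d f = 0}
  mul_mem' := by
    classical
    rintro f g ⟨hf, N, hN⟩ ⟨hg, M, hM⟩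
    refine ⟨fun σ => by rw [map_mul, hf, hg], N + M, fun d hd => ?_⟩
    rw [MvPowerSeries.coeff_mul]
    refine Finset.sum_eq_zero fun p hp => ?_
    replace hp := Finset.HasAntidiagonal.mem_antidiagonal.1 hp
    have hdeg : p.1.degree + p.2.degree = d.degree := by rw [← hp, map_add]
    rcases lt_or_ge N p.1.degree with h | h
    · rw [hN _ h, zero_mul]
    · rw [hM _ (by omega), mul_zero]
  add_mem' := by
    rintro f g ⟨hf, N, hN⟩ ⟨hg, M, hM⟩
    refine ⟨fun σ => by rw [map_add, hf, hg], max N M, fun d hd => ?_⟩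
    rw [map_add, hN _ (lt_of_le_of_lt (le_max_left _ _) hd),
      hM _ (lt_of_le_of_lt (le_max_right _ _) hd), add_zero]
  algebraMap_mem' := by
    classical
    intro r
    refine ⟨fun σ => AlgEquiv.commutes _ r, 0, fun d hd => ?_⟩
    rw [MvPowerSeries.algebraMap_apply, MvPowerSeries.coeff_C, if_neg]
    rintro rfl
    simp at hd

theorem coeff_renameEquiv (σ : Equiv.Perm ℕ) (f : MvPowerSeries ℕ ℚ) (d : ℕ →₀ ℕ) :
    MvPowerSeries.coeff (d.mapDomain σ) (MvPowerSeries.renameEquiv ℚ σ f) =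
      MvPowerSeries.coeff d f := by
  have := MvPowerSeries.coeff_embDomain_rename σ.toEmbedding f d
  rw [Finsupp.embDomain_eq_mapDomain] at this
  exact this

theorem renameEquiv_eq_self_iff (f : MvPowerSeries ℕ ℚ) :
    (∀ σ : Equiv.Perm ℕ, MvPowerSeries.renameEquiv ℚ σ f = f) ↔
      ∀ (σ : Equiv.Perm ℕ) (d : ℕ →₀ ℕ),
        MvPowerSeries.coeff (d.mapDomain σ) f = MvPowerSeries.coeff d f := by
  constructor
  · intro h σ d
    conv_lhs => rw [← h σ]
    exact coeff_renameEquiv σ f d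
  · intro h σ
    ext d
    have hd : d = (d.mapDomain σ.symm).mapDomain σ := by
      rw [← Finsupp.mapDomain_comp]; simp
    rw [hd, coeff_renameEquiv, h σ]

theorem degree_mapDomain_perm (σ : Equiv.Perm ℕ) (d : ℕ →₀ ℕ) :
    (d.mapDomain σ).degree = d.degree := by
  exact Finsupp.degree_mapDomain _ _

/-- The complete homogeneous symmetric function `h k`: the sum of all monomials of degree `k`. -/
def h (k : ℕ) : Lambda :=
  ⟨fun d => if d.degree = k then 1 else 0, by
    refine ⟨(renameEquiv_eq_self_iff _).2 fun σ d => ?_, k, fun d hd => ?_⟩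
    · change (if (d.mapDomain σ).degree = k then (1 : ℚ) else 0) = if d.degree = k then 1 else 0
      rw [degree_mapDomain_perm]
    · exact if_neg hd.ne'⟩

theorem coeff_h (k : ℕ) (d : ℕ →₀ ℕ) :
    MvPowerSeries.coeff d (h k : MvPowerSeries ℕ ℚ) = if d.degree = k then 1 else 0 := rfl

/-! Finitely many variables -/

def hFin (n k : ℕ) : MvPolynomial (Fin n) ℚ :=
  ∑ d ∈ Finset.finsuppAntidiag (Finset.univ : Finset (Fin n)) k, MvPolynomial.monomial d 1

theorem coeff_hFin (n k : ℕ) (d : Fin n →₀ ℕ) :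
    (hFin n k).coeff d = if d.degree = k then 1 else 0 := by
  classical
  simp [hFin, MvPolynomial.coeff_sum, MvPolynomial.coeff_monomial, Finset.mem_finsuppAntidiag,
    Finsupp.degree_eq_sum]

theorem hFin_zero (n : ℕ) : hFin n 0 = 1 := by
  classical
  ext d
  rw [coeff_hFin, MvPolynomial.coeff_one]
  simp [eq_comm (a := (0 : Fin n →₀ ℕ)), Finsupp.degree_eq_zero_iff]

theorem hFin_isSymmetric (n k : ℕ) : (hFin n k).IsSymmetric := by
  intro σ
  ext d
  have hd : d = (d.mapDomain σ.symm).mapDomain σ := by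
    rw [← Finsupp.mapDomain_comp]; simp
  rw [hd, MvPolynomial.coeff_rename_mapDomain _ σ.injective, coeff_hFin, coeff_hFin]
  congr 2
  rw [← hd]
  simp [Finsupp.degree_eq_sum, Finsupp.mapDomain_equiv_apply]
  exact (Equiv.sum_comp σ d)

theorem sum_esymm_mul_hFin (n k : ℕ) (hk : 0 < k) :
    ∑ p ∈ Finset.HasAntidiagonal.antidiagonal k,
      (-1) ^ p.1 * MvPolynomial.esymm (Fin n) ℚ p.1 * hFin n p.2 = 0 := by
  classical
  let E : PowerSeries (MvPolynomial (Fin n) ℚ) :=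
    ∏ i : Fin n, (1 - PowerSeries.C (MvPolynomial.X i) * PowerSeries.X)
  let H : PowerSeries (MvPolynomial (Fin n) ℚ) :=
    ∏ i : Fin n, PowerSeries.mk fun k => (MvPolynomial.X i) ^ k
  have hEH : E * H = 1 := by
    rw [← Finset.prod_mul_distrib]
    refine Finset.prod_eq_one fun i _ => ?_
    ext1 m
    cases m with
    | zero => simp
    | succ m =>
      rw [sub_mul, one_mul, mul_assoc, map_sub, PowerSeries.coeff_C_mul,
        PowerSeries.coeff_succ_X_mul]
      simp [PowerSeries.coeff_one, pow_succ']
  have hE : ∀ m, PowerSeries.coeff m E = (-1) ^ m * MvPolynomial.esymm (Fin n) ℚ m := by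
    intro m
    have : E = ∑ s ∈ (Finset.univ : Finset (Fin n)).powerset,
        PowerSeries.C ((-1) ^ s.card * ∏ i ∈ s, MvPolynomial.X i) * PowerSeries.X ^ s.card := by
      have : E = ∏ i : Fin n, (1 + PowerSeries.C (-MvPolynomial.X i) * PowerSeries.X) := by
        simp [E, sub_eq_add_neg]
      rw [this, Finset.prod_one_add]
      refine Finset.sum_congr rfl fun s _ => ?_
      rw [Finset.prod_mul_distrib, Finset.prod_const, ← map_prod]
      congr 2
      rw [Finset.prod_neg]
    rw [this, map_sum]
    simp_rw [PowerSeries.coeff_C_mul, PowerSeries.coeff_X_pow]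
    rw [MvPolynomial.esymm, Finset.mul_sum, Finset.powersetCard_eq_filter, Finset.sum_filter]
    refine Finset.sum_congr rfl fun s _ => ?_
    by_cases hs : s.card = m
    · simp [hs]
    · simp [hs, Ne.symm hs]
  have hH : ∀ m, PowerSeries.coeff m H = hFin n m := by
    intro m
    rw [PowerSeries.coeff_prod, hFin]
    refine Finset.sum_congr rfl fun d _ => ?_
    rw [MvPolynomial.monomial_eq]
    simp [Finsupp.prod_fintype]
  have := congrArg (PowerSeries.coeff k) hEH
  rw [PowerSeries.coeff_mul, PowerSeries.coeff_one, if_neg hk.ne'] at this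
  simpa only [hE, hH] using this

theorem esymm_mem_adjoin (n : ℕ) (k : ℕ) (hk : k ≤ n) :
    MvPolynomial.esymm (Fin n) ℚ k ∈
      Algebra.adjoin ℚ (Set.range fun i : Fin n => hFin n (i + 1)) := by
  induction k using Nat.strong_induction_on with
  | _ k ih =>
    rcases Nat.eq_zero_or_pos k with rfl | hpos
    · rw [MvPolynomial.esymm_zero]; exact one_mem _
    · have h0 := sum_esymm_mul_hFin n k hpos
      rw [Finset.Nat.sum_antidiagonal_eq_sum_range_succ_mk, Finset.sum_range_succ] at h0
      simp only [Nat.sub_self, hFin_zero, mul_one] at h0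
      have h1 : MvPolynomial.esymm (Fin n) ℚ k = -((-1) ^ k * ∑ i ∈ Finset.range k,
          (-1) ^ i * MvPolynomial.esymm (Fin n) ℚ i * hFin n (k - i)) := by
        rw [eq_neg_of_add_eq_zero_left h0]
        rw [mul_neg, neg_neg, ← mul_assoc, ← pow_add, ← two_mul]
        simp
      rw [h1]
      refine neg_mem (mul_mem (pow_mem (neg_mem (one_mem _)) _) (sum_mem fun i hi => ?_))
      rw [Finset.mem_range] at hi
      refine mul_mem (mul_mem (pow_mem (neg_mem (one_mem _)) _) (ih i hi (by omega))) ?_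
      refine Algebra.subset_adjoin ⟨⟨k - i - 1, by omega⟩, ?_⟩
      show hFin n (k - i - 1 + 1) = _
      congr 1
      omega

def hFinHom (n : ℕ) : MvPolynomial (Fin n) ℚ →ₐ[ℚ] MvPolynomial.symmetricSubalgebra (Fin n) ℚ :=
  MvPolynomial.aeval fun i => ⟨hFin n (i + 1), hFin_isSymmetric n _⟩

theorem val_hFinHom (n : ℕ) (P : MvPolynomial (Fin n) ℚ) :
    (hFinHom n P : MvPolynomial (Fin n) ℚ) =
      MvPolynomial.aeval (fun i : Fin n => hFin n (i + 1)) P := by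
  have : (MvPolynomial.symmetricSubalgebra (Fin n) ℚ).val.comp (hFinHom n) =
      MvPolynomial.aeval (fun i : Fin n => hFin n (i + 1)) := by
    ext i
    simp [hFinHom]
  exact DFunLike.congr_fun this P

theorem hFinHom_surjective (n : ℕ) : Function.Surjective (hFinHom n) := by
  rintro ⟨p, hp⟩
  obtain ⟨Q, hQ⟩ := (MvPolynomial.esymmAlgEquiv (R := ℚ) (Fin n) (Fintype.card_fin n)).surjective
    ⟨p, hp⟩
  have hmem : p ∈ Algebra.adjoin ℚ (Set.range fun i : Fin n => hFin n (i + 1)) := by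
    have : p = MvPolynomial.aeval (fun i : Fin n => MvPolynomial.esymm (Fin n) ℚ (i + 1)) Q := by
      rw [← MvPolynomial.esymmAlgHom_apply (σ := Fin n) (R := ℚ)]
      exact (congrArg Subtype.val hQ).symm
    rw [this, ← SetLike.mem_coe]
    have h2 : Algebra.adjoin ℚ (Set.range fun i : Fin n => MvPolynomial.esymm (Fin n) ℚ (i + 1)) ≤
        Algebra.adjoin ℚ (Set.range fun i : Fin n => hFin n (i + 1)) := by
      refine Algebra.adjoin_le ?_
      rintro _ ⟨i, rfl⟩
      exact esymm_mem_adjoin n _ i.2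
    refine h2 ?_
    rw [Algebra.adjoin_range_eq_range_aeval]
    exact ⟨Q, rfl⟩
  rw [Algebra.adjoin_range_eq_range_aeval] at hmem
  obtain ⟨P, hP⟩ := hmem
  exact ⟨P, Subtype.ext ((val_hFinHom n P).trans hP)⟩

theorem hFinHom_injective (n : ℕ) : Function.Injective (hFinHom n) := by
  let e := (MvPolynomial.esymmAlgEquiv (R := ℚ) (Fin n) (Fintype.card_fin n)).symm
  let φ : MvPolynomial (Fin n) ℚ →ₐ[ℚ] MvPolynomial (Fin n) ℚ := e.toAlgHom.comp (hFinHom n)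
  have hs : Function.Surjective φ := e.surjective.comp (hFinHom_surjective n)
  have hi : Function.Injective φ := by
    let I : ℕ →o Ideal (MvPolynomial (Fin n) ℚ) :=
      { toFun := fun k => RingHom.ker (φ ^ k)
        monotone' := monotone_nat_of_le_succ fun k x hx => by
          change (φ ^ (k + 1)) x = 0
          change (φ ^ k) x = 0 at hx
          rw [pow_succ', AlgHom.mul_apply, hx, map_zero] }
    obtain ⟨m, hm⟩ := monotone_stabilizes_iff_noetherian.2
      (inferInstance : IsNoetherianRing (MvPolynomial (Fin n) ℚ)) I
    rw [injective_iff_map_eq_zero]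
    intro x hx
    have hsm : ∀ k, Function.Surjective (φ ^ k : MvPolynomial (Fin n) ℚ →ₐ[ℚ] _) := by
      intro k
      rw [AlgHom.coe_pow]
      exact hs.iterate k
    obtain ⟨y, rfl⟩ := hsm m x
    have h1 : y ∈ I (m + 1) := by
      change (φ ^ (m + 1)) y = 0
      rw [pow_succ', AlgHom.mul_apply, hx]
    rw [← hm (m + 1) (Nat.le_succ m)] at h1
    exact h1
  exact Function.Injective.of_comp (f := e) hi


theorem coeff_mapDomain_perm (f : Lambda) (σ : Equiv.Perm ℕ) (d : ℕ →₀ ℕ) :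
    MvPowerSeries.coeff (d.mapDomain σ) (f : MvPowerSeries ℕ ℚ) =
      MvPowerSeries.coeff d (f : MvPowerSeries ℕ ℚ) :=
  (renameEquiv_eq_self_iff _).1 f.2.1 σ d

def restrict (n : ℕ) : Lambda →ₐ[ℚ] MvPowerSeries (Fin n) ℚ :=
  (MvPowerSeries.killCompl Fin.valEmbedding).comp Lambda.val

theorem coeff_restrict (n : ℕ) (f : Lambda) (d : Fin n →₀ ℕ) :
    MvPowerSeries.coeff d (restrict n f) =
      MvPowerSeries.coeff (d.embDomain Fin.valEmbedding) (f : MvPowerSeries ℕ ℚ) := rfl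

theorem restrict_h (n k : ℕ) : restrict n (h k) = (hFin n k : MvPowerSeries (Fin n) ℚ) := by
  ext d
  rw [coeff_restrict, coeff_h, MvPolynomial.coeff_coe, coeff_hFin, Finsupp.embDomain_eq_mapDomain,
    Finsupp.degree_mapDomain]

def hHom : MvPolynomial ℕ ℚ →ₐ[ℚ] Lambda := MvPolynomial.aeval fun k => h (k + 1)

theorem restrict_hHom (n : ℕ) (Q : MvPolynomial (Fin n) ℚ) :
    restrict n (hHom (MvPolynomial.rename Fin.val Q)) =
      ((hFinHom n Q : MvPolynomial (Fin n) ℚ) : MvPowerSeries (Fin n) ℚ) := by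
  have : ((restrict n).comp hHom).comp (MvPolynomial.rename Fin.val) =
      (MvPolynomial.coeToMvPowerSeries.algHom ℚ).comp
        ((MvPolynomial.symmetricSubalgebra (Fin n) ℚ).val.comp (hFinHom n)) := by
    ext1 i
    simp [hHom, hFinHom, restrict_h]
  have := DFunLike.congr_fun this Q
  simpa using this

theorem hHom_injective : Function.Injective hHom := by
  rw [injective_iff_map_eq_zero]
  intro P hP
  obtain ⟨n, hn⟩ : ∃ n : ℕ, ∀ i ∈ P.vars, i < n :=
    ⟨P.vars.sup id + 1, fun i hi => Nat.lt_succ_of_le (Finset.le_sup (f := id) hi)⟩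
  obtain ⟨Q, rfl⟩ := MvPolynomial.exists_rename_eq_of_vars_subset_range P (Fin.val : Fin n → ℕ)
    Fin.val_injective (fun i hi => ⟨⟨i, hn i hi⟩, rfl⟩)
  have h1 := restrict_hHom n Q
  rw [hP, map_zero] at h1
  have h2 : (hFinHom n Q : MvPolynomial (Fin n) ℚ) = 0 := by
    apply MvPolynomial.coe_injective
    rw [← h1, MvPolynomial.coe_zero]
  have h3 : Q = 0 := hFinHom_injective n (by rw [map_zero]; exact Subtype.ext h2)
  rw [h3, map_zero]

def wt (a : ℕ →₀ ℕ) : ℕ := a.sum fun k m => m * (k + 1)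

theorem coeff_mul_of_homog {f g : MvPowerSeries ℕ ℚ} {k l : ℕ}
    (hf : ∀ d : ℕ →₀ ℕ, d.degree ≠ k → MvPowerSeries.coeff d f = 0)
    (hg : ∀ d : ℕ →₀ ℕ, d.degree ≠ l → MvPowerSeries.coeff d g = 0) :
    ∀ d : ℕ →₀ ℕ, d.degree ≠ k + l → MvPowerSeries.coeff d (f * g) = 0 := by
  classical
  intro d hd
  rw [MvPowerSeries.coeff_mul]
  refine Finset.sum_eq_zero fun p hp => ?_
  replace hp := Finset.HasAntidiagonal.mem_antidiagonal.1 hp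
  have hdeg : p.1.degree + p.2.degree = d.degree := by rw [← hp, map_add]
  by_cases h1 : p.1.degree = k
  · rw [hg _ (by omega), mul_zero]
  · rw [hf _ h1, zero_mul]

theorem hHom_monomial (a : ℕ →₀ ℕ) (c : ℚ) :
    hHom (MvPolynomial.monomial a c) = c • a.prod fun k m => h (k + 1) ^ m := by
  rw [hHom, MvPolynomial.aeval_monomial, Algebra.smul_def]

theorem coeff_hHom_monomial (a : ℕ →₀ ℕ) (c : ℚ) (d : ℕ →₀ ℕ) (hd : d.degree ≠ wt a) :
    MvPowerSeries.coeff d (hHom (MvPolynomial.monomial a c) : MvPowerSeries ℕ ℚ) = 0 := by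
  classical
  have key : ∀ (k m : ℕ) (d : ℕ →₀ ℕ), d.degree ≠ m * (k + 1) →
      MvPowerSeries.coeff d ((h (k + 1) : MvPowerSeries ℕ ℚ) ^ m) = 0 := by
    intro k m
    induction m with
    | zero =>
      intro d hd
      rw [pow_zero, MvPowerSeries.coeff_one, if_neg]
      rintro rfl
      simp at hd
    | succ m ih =>
      rw [pow_succ, Nat.succ_mul]
      exact coeff_mul_of_homog ih (fun d hd => by rw [coeff_h, if_neg hd])
  have key2 : ∀ (s : Finset ℕ) (d : ℕ →₀ ℕ), d.degree ≠ ∑ k ∈ s, a k * (k + 1) →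
      MvPowerSeries.coeff d (∏ k ∈ s, (h (k + 1) : MvPowerSeries ℕ ℚ) ^ (a k)) = 0 := by
    intro s
    induction s using Finset.induction_on with
    | empty =>
      intro d hd
      rw [Finset.prod_empty, MvPowerSeries.coeff_one, if_neg]
      rintro rfl
      simp at hd
    | insert k s hk ih =>
      rw [Finset.prod_insert hk, Finset.sum_insert hk]
      exact coeff_mul_of_homog (key k _) ih
  rw [hHom_monomial, Finsupp.prod]
  push_cast
  rw [MvPowerSeries.coeff_smul, key2 _ d hd, mul_zero]

theorem exists_perm_embDomain (n : ℕ) (d : ℕ →₀ ℕ) (hd : d.degree ≤ n) :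
    ∃ (σ : Equiv.Perm ℕ) (e : Fin n →₀ ℕ), d.mapDomain σ = e.embDomain Fin.valEmbedding := by
  classical
  have hcard : d.support.card ≤ n := by
    refine le_trans ?_ hd
    rw [Finsupp.degree_apply, Finset.card_eq_sum_ones]
    exact Finset.sum_le_sum fun i hi => Nat.one_le_iff_ne_zero.2 (Finsupp.mem_support_iff.1 hi)
  obtain ⟨g, hg⟩ : ∃ g : d.support ↪ Fin n, True := by
    have : Fintype.card d.support ≤ Fintype.card (Fin n) := by simpa using hcard
    exact ⟨(Function.Embedding.nonempty_of_card_le this).some, trivial⟩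
  have hinj : Function.Injective fun i : d.support => ((g i : Fin n) : ℕ) :=
    Fin.val_injective.comp g.injective
  obtain ⟨σ, hσ⟩ : ∃ σ : Equiv.Perm ℕ, ∀ i : d.support, σ i = g i :=
    Equiv.Perm.exists_extending_pair (fun i : d.support => (i : ℕ)) (fun i => ((g i : Fin n) : ℕ))
      Subtype.val_injective hinj
  refine ⟨σ, (d.mapDomain σ).comapDomain Fin.val Fin.val_injective.injOn, ?_⟩
  rw [Finsupp.embDomain_eq_mapDomain]
  refine (Finsupp.mapDomain_comapDomain _ Fin.val_injective _ ?_).symm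
  intro j hj
  have hj' := Finsupp.mapDomain_support hj
  rw [Finset.mem_image] at hj'
  obtain ⟨i, hi, rfl⟩ := hj'
  exact ⟨g ⟨i, hi⟩, (hσ ⟨i, hi⟩).symm⟩

theorem hHom_surjective : Function.Surjective hHom := by
  classical
  intro f
  obtain ⟨n, hn⟩ := f.2.2
  let p : MvPolynomial (Fin n) ℚ :=
    ∑ d ∈ (Finset.range (n + 1)).biUnion
      (fun k => Finset.finsuppAntidiag (Finset.univ : Finset (Fin n)) k),
      MvPolynomial.monomial d (MvPowerSeries.coeff d (restrict n f))
  have hp : (p : MvPowerSeries (Fin n) ℚ) = restrict n f := by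
    ext d
    rw [MvPolynomial.coeff_coe, MvPolynomial.coeff_sum]
    simp only [MvPolynomial.coeff_monomial, Finset.sum_ite_eq', Finset.mem_biUnion,
      Finset.mem_range, Finset.mem_finsuppAntidiag, Finset.subset_univ, and_true]
    split_ifs with hd
    · rfl
    · rw [coeff_restrict, hn]
      rw [Finsupp.embDomain_eq_mapDomain, Finsupp.degree_mapDomain, Finsupp.degree_eq_sum]
      by_contra hlt
      exact hd ⟨_, Nat.lt_succ_of_le (not_lt.1 hlt), rfl⟩
  have hsymm : p.IsSymmetric := by
    intro σ
    ext d
    have hd : d = (d.mapDomain σ.symm).mapDomain σ := by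
      rw [← Finsupp.mapDomain_comp]; simp
    rw [hd, MvPolynomial.coeff_rename_mapDomain _ σ.injective, ← hd,
      ← MvPolynomial.coeff_coe, ← MvPolynomial.coeff_coe, hp, coeff_restrict, coeff_restrict]
    let τ : Equiv.Perm ℕ := Equiv.Perm.extendDomain σ.symm
      (Equiv.ofInjective (Fin.val : Fin n → ℕ) Fin.val_injective)
    have hτ : ∀ i : Fin n, τ i = σ.symm i := fun i =>
      Equiv.Perm.extendDomain_apply_image σ.symm
        (Equiv.ofInjective (Fin.val : Fin n → ℕ) Fin.val_injective) i
    rw [← coeff_mapDomain_perm f τ (d.embDomain _)]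
    congr 2
    rw [Finsupp.embDomain_eq_mapDomain, Finsupp.embDomain_eq_mapDomain, ← Finsupp.mapDomain_comp,
      ← Finsupp.mapDomain_comp]
    congr 1
    funext i
    exact (hτ i).symm
  obtain ⟨Q, hQ⟩ := hFinHom_surjective n ⟨p, hsymm⟩
  let P := MvPolynomial.rename Fin.val Q
  have hP : restrict n (hHom P) = restrict n f := by
    rw [restrict_hHom, hQ, hp]
  let P' : MvPolynomial ℕ ℚ :=
    ∑ a ∈ P.support with wt a ≤ n, MvPolynomial.monomial a (P.coeff a)
  have hPsum : hHom P = ∑ a ∈ P.support, hHom (MvPolynomial.monomial a (P.coeff a)) := by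
    conv_lhs => rw [MvPolynomial.as_sum P, map_sum]
  refine ⟨P', Subtype.ext ?_⟩
  ext d
  by_cases hd : d.degree ≤ n
  · have h1 : MvPowerSeries.coeff d (hHom P' : MvPowerSeries ℕ ℚ) =
        MvPowerSeries.coeff d (hHom P : MvPowerSeries ℕ ℚ) := by
      rw [hPsum, map_sum]
      push_cast
      rw [map_sum, map_sum, Finset.sum_filter]
      refine Finset.sum_congr rfl fun a _ => ?_
      split_ifs with ha
      · rfl
      · rw [coeff_hHom_monomial _ _ _ (by omega)]
    rw [h1]
    obtain ⟨σ, e, he⟩ := exists_perm_embDomain n d hd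
    rw [← coeff_mapDomain_perm _ σ, ← coeff_mapDomain_perm f σ, he, ← coeff_restrict,
      ← coeff_restrict, hP]
  · rw [hn d (by omega), map_sum]
    push_cast
    rw [map_sum]
    refine Finset.sum_eq_zero fun a ha => coeff_hHom_monomial _ _ _ ?_
    have := (Finset.mem_filter.1 ha).2
    omega

def hMonomialBasis : Module.Basis (ℕ →₀ ℕ) ℚ Lambda :=
  (MvPolynomial.basisMonomials ℕ ℚ).map
    (AlgEquiv.ofBijective hHom ⟨hHom_injective, hHom_surjective⟩).toLinearEquiv

theorem hMonomialBasis_apply (a : ℕ →₀ ℕ) :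
    hMonomialBasis a = a.prod fun k m => h (k + 1) ^ m := by
  have := hHom_monomial a 1
  rw [one_smul] at this
  rw [← this, hMonomialBasis, Module.Basis.map_apply, MvPolynomial.coe_basisMonomials]
  rfl

/-- The exponent vector `(μ₁, μ₂, …)` of the monomial `x^μ`. -/
def exponent (μ : YoungDiagram) : ℕ →₀ ℕ :=
  Finsupp.onFinset (Finset.range (μ.colLen 0)) μ.rowLen fun i hi => by
    rw [Finset.mem_range, ← YoungDiagram.mem_iff_lt_colLen, YoungDiagram.mem_iff_lt_rowLen]
    exact Nat.pos_of_ne_zero hi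

theorem exponent_apply (μ : YoungDiagram) (i : ℕ) : exponent μ i = μ.rowLen i := rfl

theorem support_exponent (μ : YoungDiagram) :
    (exponent μ).support = Finset.range (μ.colLen 0) := by
  ext i
  rw [Finsupp.mem_support_iff, exponent_apply, Finset.mem_range, ← YoungDiagram.mem_iff_lt_colLen,
    YoungDiagram.mem_iff_lt_rowLen, Nat.pos_iff_ne_zero]

theorem exponent_parts (μ : YoungDiagram) :
    (exponent μ).support.val.map (exponent μ) = (μ.rowLens : Multiset ℕ) := by
  rw [support_exponent, YoungDiagram.rowLens]
  rfl

theorem rowLens_injective {μ ν : YoungDiagram}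
    (hμν : (μ.rowLens : Multiset ℕ) = (ν.rowLens : Multiset ℕ)) : μ = ν := by
  apply YoungDiagram.equivListRowLens.injective
  apply Subtype.ext
  rw [Multiset.coe_eq_coe] at hμν
  exact hμν.eq_of_pairwise' μ.rowLens_sorted.pairwise ν.rowLens_sorted.pairwise

/-- The monomial symmetric function `m_μ`: the sum of all distinct monomials whose nonzero
exponents are, in some order, the parts of `μ`. -/
def m (μ : YoungDiagram) : Lambda :=
  ⟨fun d => if d.support.val.map d = (μ.rowLens : Multiset ℕ) then 1 else 0, by
    refine ⟨(renameEquiv_eq_self_iff _).2 fun σ d => ?_, μ.rowLens.sum, fun d hd => ?_⟩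
    · change (if (d.mapDomain σ).support.val.map (d.mapDomain σ) = (μ.rowLens : Multiset ℕ)
        then (1 : ℚ) else 0) = if d.support.val.map d = (μ.rowLens : Multiset ℕ) then 1 else 0
      congr 2
      have hσ : d.mapDomain σ = d.embDomain σ.toEmbedding :=
        (Finsupp.embDomain_eq_mapDomain σ.toEmbedding d).symm
      rw [hσ, Finsupp.support_embDomain,
        Finset.map_val, Multiset.map_map]
      refine Multiset.map_congr rfl fun i _ => ?_
      exact Finsupp.embDomain_apply_self σ.toEmbedding d i
    · refine if_neg fun heq => ?_
      have := congrArg Multiset.sum heq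
      rw [Multiset.sum_coe] at this
      have h2 : (d.support.val.map d).sum = d.degree := rfl
      omega⟩

theorem coeff_m (μ : YoungDiagram) (d : ℕ →₀ ℕ) :
    MvPowerSeries.coeff d (m μ : MvPowerSeries ℕ ℚ) =
      if d.support.val.map d = (μ.rowLens : Multiset ℕ) then 1 else 0 := rfl

/-- `h_μ = h_{μ₁} h_{μ₂} ⋯`, the product over the parts of `μ`. -/
def hPart (μ : YoungDiagram) : Lambda := (μ.rowLens.map h).prod

def multiplicities (μ : YoungDiagram) : ℕ →₀ ℕ :=
  Multiset.toFinsupp ((μ.rowLens : Multiset ℕ).map Nat.pred)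

theorem multiplicities_bijective : Function.Bijective multiplicities := by
  have key : ∀ μ : YoungDiagram,
      ((μ.rowLens : Multiset ℕ).map Nat.pred).map Nat.succ = (μ.rowLens : Multiset ℕ) := by
    intro μ
    rw [Multiset.map_map]
    conv_rhs => rw [← Multiset.map_id (μ.rowLens : Multiset ℕ)]
    refine Multiset.map_congr rfl fun x hx => ?_
    exact Nat.succ_pred_eq_of_pos (μ.pos_of_mem_rowLens x (by simpa using hx))
  constructor
  · intro μ ν hμν
    have h1 := Multiset.toFinsupp.injective hμν
    apply rowLens_injective
    rw [← key μ, ← key ν, h1]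
  · intro a
    let s : Multiset ℕ := (Multiset.toFinsupp.symm a).map Nat.succ
    let l : List ℕ := s.sort (· ≥ ·)
    have hl : l.SortedGE := (Multiset.pairwise_sort s (· ≥ ·)).sortedGE
    refine ⟨YoungDiagram.ofRowLens l hl, ?_⟩
    have hpos : ∀ x ∈ l, 0 < x := by
      intro x hx
      rw [Multiset.mem_sort, Multiset.mem_map] at hx
      obtain ⟨y, -, rfl⟩ := hx
      exact Nat.succ_pos y
    rw [multiplicities, YoungDiagram.rowLens_ofRowLens_eq_self hpos, Multiset.sort_eq,
      Multiset.map_map]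
    simp

theorem multiplicities_prod (μ : YoungDiagram) :
    ((multiplicities μ).prod fun k j => h (k + 1) ^ j) = hPart μ := by
  have h1 : ∀ s : Multiset ℕ,
      ((Multiset.toFinsupp s).prod fun k j => h (k + 1) ^ j) =
        (s.map fun k => h (k + 1)).prod := by
    intro s
    rw [Finset.prod_multiset_map_count]
    rfl
  rw [multiplicities, h1, Multiset.map_map, hPart, ← Multiset.prod_coe, ← Multiset.map_coe]
  congr 1
  refine Multiset.map_congr rfl fun x hx => ?_
  have := μ.pos_of_mem_rowLens x (by simpa using hx)
  rw [Function.comp_apply]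
  congr 1
  exact Nat.succ_pred_eq_of_pos this

/-- The functions `h_μ`, for `μ` a partition, form a basis of `Λ`. -/
def hBasis : Module.Basis YoungDiagram ℚ Lambda :=
  hMonomialBasis.reindex (Equiv.ofBijective multiplicities multiplicities_bijective).symm

theorem hBasis_apply (μ : YoungDiagram) : hBasis μ = hPart μ := by
  rw [hBasis, Module.Basis.reindex_apply, Equiv.symm_symm, Equiv.ofBijective_apply,
    hMonomialBasis_apply, multiplicities_prod]

/-- The Hall inner product `⟨f, g⟩ = hall f g` on `Λ`, for which the bases `(m_μ)` and `(h_μ)` are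
dual to each other. Equivalently, `⟨f, h_μ⟩` is the coefficient of `x^μ` in `f`; this is how it is
constructed here, by linear extension in the second argument. -/
def hall : Lambda →ₗ[ℚ] Lambda →ₗ[ℚ] ℚ :=
  (hBasis.constr ℚ fun μ => (MvPowerSeries.coeff (exponent μ)).comp Lambda.val.toLinearMap).flip

theorem hall_hPart (f : Lambda) (μ : YoungDiagram) :
    hall f (hPart μ) = MvPowerSeries.coeff (exponent μ) (f : MvPowerSeries ℕ ℚ) := by
  rw [hall, LinearMap.flip_apply, ← hBasis_apply, Module.Basis.constr_basis]
  rfl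

open Classical in
theorem hall_m_hPart (μ ν : YoungDiagram) :
    hall (m μ) (hPart ν) = if μ = ν then 1 else 0 := by
  rw [hall_hPart, coeff_m, exponent_parts]
  refine if_congr ⟨fun heq => (rowLens_injective heq).symm, ?_⟩ rfl rfl
  rintro rfl
  rfl

/-- Plethysm by the power sum `p_t`: the substitution `f(x₀, x₁, …) ↦ f(x₀^t, x₁^t, …)`. -/
def plethysm (t : ℕ) (ht : t ≠ 0) : Lambda →ₐ[ℚ] Lambda :=
  ((MvPowerSeries.expand t ht).comp Lambda.val).codRestrict Lambda fun f => by
    have key : ∀ d : ℕ →₀ ℕ, (∃ e : ℕ →₀ ℕ, d = t • e) ∨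
        MvPowerSeries.coeff d (MvPowerSeries.expand t ht (f : MvPowerSeries ℕ ℚ)) = 0 := by
      intro d
      by_cases hd : ∀ i, t ∣ d i
      · refine Or.inl ⟨d.mapRange (· / t) (Nat.zero_div t), ?_⟩
        ext i
        simp [Nat.mul_div_cancel' (hd i)]
      · push Not at hd
        obtain ⟨i, hi⟩ := hd
        exact Or.inr (MvPowerSeries.coeff_expand_of_not_dvd t ht _ hi)
    have hle : ∀ (σ : Equiv.Perm ℕ) (d e : ℕ →₀ ℕ), d = t • e →
        MvPowerSeries.coeff (d.mapDomain σ)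
          (MvPowerSeries.expand t ht (f : MvPowerSeries ℕ ℚ)) =
        MvPowerSeries.coeff d (MvPowerSeries.expand t ht (f : MvPowerSeries ℕ ℚ)) := by
      rintro σ d e rfl
      rw [Finsupp.mapDomain_smul, MvPowerSeries.coeff_expand_smul,
        MvPowerSeries.coeff_expand_smul, coeff_mapDomain_perm]
    obtain ⟨N, hN⟩ := f.2.2
    refine ⟨(renameEquiv_eq_self_iff _).2 fun σ d => ?_, t * N, fun d hd => ?_⟩
    · change MvPowerSeries.coeff _ (MvPowerSeries.expand t ht (f : MvPowerSeries ℕ ℚ)) =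
        MvPowerSeries.coeff _ (MvPowerSeries.expand t ht (f : MvPowerSeries ℕ ℚ))
      have hback : (d.mapDomain σ).mapDomain σ.symm = d := by
        rw [← Finsupp.mapDomain_comp]; simp
      rcases key d with ⟨e, he⟩ | h0
      · exact hle σ d e he
      · rcases key (d.mapDomain σ) with ⟨e, he⟩ | h1
        · have := hle σ.symm _ e he
          rw [hback] at this
          exact this.symm
        · rw [h0, h1]
    · change MvPowerSeries.coeff _ (MvPowerSeries.expand t ht (f : MvPowerSeries ℕ ℚ)) = 0
      rcases key d with ⟨e, rfl⟩ | h0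
      · rw [MvPowerSeries.coeff_expand_smul, hN]
        rw [map_nsmul, smul_eq_mul] at hd
        exact lt_of_mul_lt_mul_left hd (Nat.zero_le t)
      · exact h0

theorem coe_plethysm (t : ℕ) (ht : t ≠ 0) (f : Lambda) :
    (plethysm t ht f : MvPowerSeries ℕ ℚ) = MvPowerSeries.expand t ht (f : MvPowerSeries ℕ ℚ) :=
  rfl

def divParts (t : ℕ) (μ : YoungDiagram) : YoungDiagram where
  cells := μ.cells.filter fun c => (c.1, t * c.2 + (t - 1)) ∈ μ
  isLowerSet := by
    rintro ⟨i2, j2⟩ ⟨i1, j1⟩ ⟨hi : i1 ≤ i2, hj : j1 ≤ j2⟩ hcell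
    simp only [Finset.coe_filter, Set.mem_ofPred_eq, YoungDiagram.mem_cells] at hcell ⊢
    exact ⟨μ.up_left_mem hi hj hcell.1,
      μ.up_left_mem hi (Nat.add_le_add_right (Nat.mul_le_mul_left t hj) _) hcell.2⟩

theorem rowLen_divParts (t : ℕ) (ht : t ≠ 0) (μ : YoungDiagram) (i : ℕ) :
    (divParts t μ).rowLen i = μ.rowLen i / t := by
  refine eq_of_forall_lt_iff fun j => ?_
  rw [← YoungDiagram.mem_iff_lt_rowLen, Nat.lt_div_iff_mul_lt (Nat.pos_of_ne_zero ht),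
    Nat.mul_comm j t]
  change (i, j) ∈ μ.cells.filter _ ↔ _
  have hpos := Nat.pos_of_ne_zero ht
  have hjt : j ≤ t * j := Nat.le_mul_of_pos_left j hpos
  rw [Finset.mem_filter, YoungDiagram.mem_cells, YoungDiagram.mem_iff_lt_rowLen,
    YoungDiagram.mem_iff_lt_rowLen]
  dsimp only
  constructor
  · rintro ⟨-, h2⟩
    omega
  · intro h2
    constructor <;> omega

/-- Plethysm by `p_t` has a unique adjoint with respect to the Hall inner product. -/
theorem existsUnique_adjoint (t : ℕ) (ht : t ≠ 0) :
    ∃! φ : Lambda →ₗ[ℚ] Lambda, ∀ f g : Lambda, hall (plethysm t ht f) g = hall f (φ g) := by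
  classical
  let φ : Lambda →ₗ[ℚ] Lambda := hBasis.constr ℚ fun μ =>
    if ∀ i, t ∣ μ.rowLen i then hPart (divParts t μ) else 0
  have hadj : ∀ f, hall (plethysm t ht f) = (hall f).comp φ := by
      intro f
      refine hBasis.ext fun μ => ?_
      rw [LinearMap.comp_apply, Module.Basis.constr_basis, hBasis_apply, hall_hPart, coe_plethysm]
      split_ifs with hμ
      · have : exponent μ = t • exponent (divParts t μ) := by
          ext i
          rw [Finsupp.smul_apply, exponent_apply, exponent_apply, rowLen_divParts t ht, smul_eq_mul,
            Nat.mul_div_cancel' (hμ i)]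
        rw [this, MvPowerSeries.coeff_expand_smul, hall_hPart]
      · push Not at hμ
        obtain ⟨i, hi⟩ := hμ
        rw [map_zero, MvPowerSeries.coeff_expand_of_not_dvd t ht _ (i := i) hi]
  refine ⟨φ, fun f g => by rw [hadj f, LinearMap.comp_apply], fun ψ hψ => ?_⟩
  · have hnd : ∀ x : Lambda, (∀ f, hall f x = 0) → x = 0 := by
      intro x hx
      rw [hBasis.ext_elem_iff]
      intro μ
      have : hall (m μ) = hBasis.coord μ := by
        refine hBasis.ext fun ν => ?_
        rw [hBasis_apply, hall_m_hPart, ← hBasis_apply, Module.Basis.coord_apply,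
          Module.Basis.repr_self, Finsupp.single_apply]
        exact if_congr eq_comm rfl rfl
      have h2 := hx (m μ)
      rw [this, Module.Basis.coord_apply] at h2
      rw [h2, map_zero, Finsupp.zero_apply]
    refine LinearMap.ext fun g => sub_eq_zero.1 (hnd _ fun f => ?_)
    have h1 : hall (plethysm t ht f) = (hall f).comp φ := hadj f
    rw [map_sub, ← hψ f g, h1, LinearMap.comp_apply, sub_self]

/-- The `t`-th Verschiebung operator `φ_t`: the adjoint of plethysm by `p_t` with respect to the
Hall inner product, i.e. the unique linear operator with `⟨f ∘ p_t, g⟩ = ⟨f, φ_t g⟩`. -/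
def verschiebung (t : ℕ) (ht : t ≠ 0) : Lambda →ₗ[ℚ] Lambda :=
  (existsUnique_adjoint t ht).choose

theorem hall_plethysm (t : ℕ) (ht : t ≠ 0) (f g : Lambda) :
    hall (plethysm t ht f) g = hall f (verschiebung t ht g) :=
  (existsUnique_adjoint t ht).choose_spec.1 f g

/-- The complete homogeneous symmetric functions indexed by integers, with `h_k = 0` for `k < 0`. -/
def hInt (k : ℤ) : Lambda := if 0 ≤ k then h k.toNat else 0

/-- The skew Schur function `s_{lam/mu}`, defined by the Jacobi–Trudi determinant
`det (h_{lam_i - mu_j - i + j})`, where `1 ≤ i, j ≤ l(lam)`. -/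
def skewSchur (lam mu : YoungDiagram) : Lambda :=
  Matrix.det (Matrix.of fun i j : Fin (lam.colLen 0) =>
    hInt ((lam.rowLen i : ℤ) - mu.rowLen j - i + j))

/-- A finite set of cells is a `t`-ribbon if it is edge-connected, contains no `2 × 2` square and
has `t` cells. Two cells are adjacent in `SimpleGraph.hasse (ℕ × ℕ)` exactly when they share an
edge. -/
structure IsRibbon (t : ℕ) (S : Finset (ℕ × ℕ)) : Prop where
  connected : ((SimpleGraph.hasse (ℕ × ℕ)).induce (S : Set (ℕ × ℕ))).Connected
  no_square : ∀ i j : ℕ,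
    ¬ ((i, j) ∈ S ∧ (i, j + 1) ∈ S ∧ (i + 1, j) ∈ S ∧ (i + 1, j + 1) ∈ S)
  card_eq : S.card = t

/-- The height of a ribbon: one less than the number of rows it occupies. -/
def ribbonHeight (S : Finset (ℕ × ℕ)) : ℕ := (S.image Prod.fst).card - 1

/-- A `t`-ribbon decomposition of `lam/mu`: partitions `mu = ν⁰ ⊆ ν¹ ⊆ ⋯ ⊆ νᵐ = lam` such that each
`νʳ⁺¹/νʳ` is a `t`-ribbon. -/
structure RibbonDecomposition (t : ℕ) (lam mu : YoungDiagram) where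
  length : ℕ
  shape : Fin (length + 1) → YoungDiagram
  shape_zero : shape 0 = mu
  shape_last : shape (Fin.last length) = lam
  shape_le : ∀ r : Fin length, shape r.castSucc ≤ shape r.succ
  isRibbon : ∀ r : Fin length, IsRibbon t ((shape r.succ).cells \ (shape r.castSucc).cells)

/-- The sign `(-1)^{∑ ht(νʳ⁺¹/νʳ)}` of a ribbon decomposition. -/
def RibbonDecomposition.sign {t : ℕ} {lam mu : YoungDiagram} (D : RibbonDecomposition t lam mu) :
    ℚ :=
  (-1) ^ ∑ r : Fin D.length,
    ribbonHeight ((D.shape r.succ).cells \ (D.shape r.castSucc).cells)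

/-- The skew shape `lam/mu` is `t`-tileable if it has a `t`-ribbon decomposition. -/
def IsTileable (t : ℕ) (lam mu : YoungDiagram) : Prop := Nonempty (RibbonDecomposition t lam mu)

/-- The position `lam_i - i` of the `i`-th bead of the Maya diagram of `lam` (with `i` counted from
`1`, so that row `i : ℕ` of the diagram gives `lam_{i+1} - (i+1)`), shifted by `-1/2` so as to be an
integer. -/
def bead (lam : YoungDiagram) (i : ℕ) : ℤ := (lam.rowLen i : ℤ) - (i + 1)

/-- The number of empty spaces on runner `r` (the positions congruent to `r` modulo `t`) of the Maya
diagram of `lam` that lie to the left of position `b`. -/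
def emptyLeft (t r : ℕ) (lam : YoungDiagram) (b : ℤ) : ℕ :=
  {e : ℤ | e < b ∧ e % (t : ℤ) = (r : ℤ) ∧ e ∉ Set.range (bead lam)}.ncard

theorem emptyLeft_mono (t r : ℕ) (lam : YoungDiagram) {b c : ℤ} (hbc : b ≤ c) :
    emptyLeft t r lam b ≤ emptyLeft t r lam c := by
  refine Set.ncard_le_ncard (fun e he => ⟨lt_of_lt_of_le he.1 hbc, he.2⟩) ?_
  refine (Set.finite_Icc (-(lam.colLen 0 : ℤ)) c).subset fun e he => ⟨?_, he.1.le⟩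
  by_contra hlt
  refine he.2.2 ⟨(-e - 1).toNat, ?_⟩
  have h0 : lam.rowLen (-e - 1).toNat = 0 := by
    by_contra hne
    have h1 := (YoungDiagram.mem_iff_lt_rowLen (μ := lam)).2 (Nat.pos_of_ne_zero hne)
    rw [YoungDiagram.mem_iff_lt_colLen] at h1
    omega
  rw [bead, h0]
  omega

/-- The component `lam^{(r)}` of Littlewood's `t`-quotient: the partition whose Maya diagram is, up
to a shift, runner `r` of the Maya diagram of `lam`. Its parts are the numbers of empty spaces of
the runner to the left of each of its beads, the beads being read from right to left. (Every bead
past the first `l(lam)` ones of `lam` has no empty space to its left.) -/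
def quotient (t r : ℕ) (lam : YoungDiagram) : YoungDiagram :=
  YoungDiagram.ofRowLens
    (((List.range (lam.colLen 0)).filter fun i => bead lam i % (t : ℤ) = (r : ℤ)).map
      fun i => emptyLeft t r lam (bead lam i)) <| by
    refine List.Pairwise.sortedGE (List.Pairwise.map _ ?_ (List.pairwise_lt_range.filter _))
    intro i j hij
    refine emptyLeft_mono t r lam ?_
    have := lam.rowLen_anti i j hij.le
    unfold bead
    omega

end SymFun

end

noncomputable section

namespace SymFun

/-! Since `h_1, h_2, …` freely generate `Λ`, there is an algebra endomorphism sending `h_k` to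
`h_{k/t}` if `t ∣ k` and to `0` otherwise. Checked against the basis `h_μ`, it is adjoint to
plethysm by `p_t`, so it is `φ_t` (`verschiebung_eq_verschiebungHom`). Being multiplicative, `φ_t`
may be applied to the entries of the Jacobi–Trudi determinant. The index of the `(i, j)` entry is
the difference of the `i`-th bead of `λ` and the `j`-th bead of `μ`, so the new entry is zero unless
these beads share a runner and the difference is nonnegative (`beadMatrix`).

If the determinant is nonzero, some term of its Leibniz expansion survives, which is a bijection
from the beads of `μ` to those of `λ` moving each bead right by a multiple of `t` (`MovesBeads`).
Adding a `t`-ribbon is the same as moving one bead `t` steps right to a free position, so such a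
bijection can be carried out ribbon by ribbon and `λ/μ` is tileable (`MovesBeads.isTileable`). This
gives the vanishing statement by contraposition.

Conversely, each ribbon of a decomposition acts on bead indices by a cycle of sign `(-1)^ht` and
never makes a bead overtake another one on its runner. The product `σ` of these cycles therefore has
the sign of the decomposition and is increasing on every runner
(`RibbonDecomposition.exists_movesBeads`). Permuting rows by `σ` makes the matrix block diagonal,
with one block per runner, and the block of runner `r` is the Jacobi–Trudi matrix of `λ^(r)/μ^(r)`
(`MovesBeads.det_beadMatrix`). Every decomposition supplies its own `σ`, so independence of the sign
from the decomposition is not needed as an input. -/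

/-! ### The Verschiebung as an algebra endomorphism. -/

theorem h_zero : h 0 = 1 := by
  classical
  ext d
  rw [coeff_h]
  push_cast
  simp only [MvPowerSeries.coeff_one, Finsupp.degree_eq_zero_iff]

/-- The algebra endomorphism of `Λ` with `h_k ↦ h_{k/t}` when `t ∣ k` and `h_k ↦ 0` otherwise. -/
def verschiebungHom (t : ℕ) : Lambda →ₐ[ℚ] Lambda :=
  (MvPolynomial.aeval fun k => if t ∣ k + 1 then h ((k + 1) / t) else 0).comp
    (AlgEquiv.ofBijective hHom ⟨hHom_injective, hHom_surjective⟩).symm.toAlgHom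

theorem verschiebungHom_h (t k : ℕ) :
    verschiebungHom t (h k) = if t ∣ k then h (k / t) else 0 := by
  cases k with
  | zero => rw [h_zero, map_one]; simp [h_zero]
  | succ k =>
    have : (AlgEquiv.ofBijective hHom ⟨hHom_injective, hHom_surjective⟩).symm (h (k + 1)) =
        MvPolynomial.X k := by
      rw [AlgEquiv.symm_apply_eq]
      simp [hHom]
    rw [verschiebungHom, AlgHom.comp_apply]
    erw [this]
    rw [MvPolynomial.aeval_X]

theorem rowLens_divParts {t : ℕ} (ht : t ≠ 0) {μ : YoungDiagram} (hμ : ∀ i, t ∣ μ.rowLen i) :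
    (divParts t μ).rowLens = μ.rowLens.map (· / t) := by
  have hcol : (divParts t μ).colLen 0 = μ.colLen 0 := by
    refine eq_of_forall_lt_iff fun i => ?_
    rw [← YoungDiagram.mem_iff_lt_colLen, ← YoungDiagram.mem_iff_lt_colLen,
      YoungDiagram.mem_iff_lt_rowLen, YoungDiagram.mem_iff_lt_rowLen, rowLen_divParts t ht]
    obtain ⟨k, hk⟩ := hμ i
    rw [hk, Nat.mul_div_cancel_left _ (Nat.pos_of_ne_zero ht)]
    have := Nat.pos_of_ne_zero ht
    constructor
    · intro h; positivity
    · intro h; exact Nat.pos_of_mul_pos_left h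
  rw [YoungDiagram.rowLens, YoungDiagram.rowLens, hcol, List.map_map]
  exact List.map_congr_left fun i _ => rowLen_divParts t ht μ i

theorem verschiebungHom_hPart {t : ℕ} (ht : t ≠ 0) (μ : YoungDiagram)
    [Decidable (∀ i, t ∣ μ.rowLen i)] :
    verschiebungHom t (hPart μ) =
      if ∀ i, t ∣ μ.rowLen i then hPart (divParts t μ) else 0 := by
  rw [hPart, map_list_prod, List.map_map]
  split_ifs with hμ
  · rw [hPart, rowLens_divParts ht hμ, List.map_map]
    congr 1
    refine List.map_congr_left fun x hx => ?_
    obtain ⟨i, -, rfl⟩ := List.mem_map.1 hx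
    simp [verschiebungHom_h, hμ i]
  · push Not at hμ
    obtain ⟨i, hi⟩ := hμ
    refine List.prod_eq_zero (List.mem_map.2 ⟨μ.rowLen i, ?_, by simp [verschiebungHom_h, hi]⟩)
    refine List.mem_map.2 ⟨i, ?_, rfl⟩
    rw [List.mem_range, ← YoungDiagram.mem_iff_lt_colLen, YoungDiagram.mem_iff_lt_rowLen]
    exact Nat.pos_of_ne_zero fun h0 => hi (h0 ▸ dvd_zero t)

/-- By uniqueness of the adjoint it suffices to test against `h_μ`. Pairing with `h_μ` extracts the
coefficient of `x^μ`, and `f(x^t)` has such a coefficient only if `t` divides every part of `μ`.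
This multiplicativity is what lets `φ_t` enter determinants. -/
theorem verschiebung_eq_verschiebungHom (t : ℕ) (ht : t ≠ 0) :
    verschiebung t ht = (verschiebungHom t).toLinearMap := by
  classical
  refine (existsUnique_adjoint t ht).unique (hall_plethysm t ht) fun f g => ?_
  have hadj : hall (plethysm t ht f) = (hall f).comp (verschiebungHom t).toLinearMap := by
    refine hBasis.ext fun μ => ?_
    rw [LinearMap.comp_apply, hBasis_apply, hall_hPart, coe_plethysm, AlgHom.toLinearMap_apply,
      verschiebungHom_hPart ht]
    split_ifs with hμ
    · have : exponent μ = t • exponent (divParts t μ) := by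
        ext i
        rw [Finsupp.smul_apply, exponent_apply, exponent_apply, rowLen_divParts t ht, smul_eq_mul,
          Nat.mul_div_cancel' (hμ i)]
      rw [this, MvPowerSeries.coeff_expand_smul, hall_hPart]
    · push Not at hμ
      obtain ⟨i, hi⟩ := hμ
      rw [map_zero, MvPowerSeries.coeff_expand_of_not_dvd t ht _ (i := i) hi]
  rw [hadj, LinearMap.comp_apply]

theorem verschiebungHom_hInt {t : ℕ} (ht : t ≠ 0) (k : ℤ) :
    verschiebungHom t (hInt k) = if (t : ℤ) ∣ k then hInt (k / t) else 0 := by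
  have htpos : (0 : ℤ) < t := by exact_mod_cast Nat.pos_of_ne_zero ht
  rcases lt_or_ge k 0 with hk | hk
  -- For negative `k` both branches vanish, because the floor quotient is negative too.
  · have : k / (t : ℤ) < 0 := Int.ediv_neg_of_neg_of_pos hk htpos
    simp [hInt, hk.not_ge, this.not_ge]
  · lift k to ℕ using hk
    have : 0 ≤ (k : ℤ) / t := by positivity
    rw [hInt, if_pos (by positivity), hInt, if_pos this, Int.toNat_natCast, verschiebungHom_h]
    norm_cast

/-! ### Young diagrams through their rows and beads. -/

theorem le_iff_rowLen_le {μ ν : YoungDiagram} : μ ≤ ν ↔ ∀ i, μ.rowLen i ≤ ν.rowLen i := by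
  constructor
  · intro hle i
    by_contra! hlt
    exact lt_irrefl _ (YoungDiagram.mem_iff_lt_rowLen.1 (hle (YoungDiagram.mem_iff_lt_rowLen.2 hlt)))
  · rintro hle ⟨i, j⟩ hc
    exact YoungDiagram.mem_iff_lt_rowLen.2 ((YoungDiagram.mem_iff_lt_rowLen.1 hc).trans_le (hle i))

theorem eq_of_rowLen_eq {μ ν : YoungDiagram} (heq : ∀ i, μ.rowLen i = ν.rowLen i) : μ = ν :=
  le_antisymm (le_iff_rowLen_le.2 fun i => (heq i).le) (le_iff_rowLen_le.2 fun i => (heq i).ge)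

theorem rowLen_eq_zero_iff {μ : YoungDiagram} {i : ℕ} : μ.rowLen i = 0 ↔ μ.colLen 0 ≤ i := by
  rw [← not_lt, ← YoungDiagram.mem_iff_lt_colLen, YoungDiagram.mem_iff_lt_rowLen]
  omega

theorem bead_strictAnti (μ : YoungDiagram) : StrictAnti (bead μ) := by
  intro i j hij
  have := μ.rowLen_anti i j hij.le
  unfold bead
  omega

theorem bead_of_colLen_le {μ : YoungDiagram} {i : ℕ} (hi : μ.colLen 0 ≤ i) :
    bead μ i = -(i + 1) := by
  rw [bead, rowLen_eq_zero_iff.2 hi]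
  simp

theorem colLen_mono {μ ν : YoungDiagram} (hle : μ ≤ ν) : μ.colLen 0 ≤ ν.colLen 0 := by
  rw [← rowLen_eq_zero_iff]
  have := le_iff_rowLen_le.1 hle (ν.colLen 0)
  rw [rowLen_eq_zero_iff.2 le_rfl] at this
  omega

theorem mem_sdiff_cells {μ ν : YoungDiagram} {i j : ℕ} :
    (i, j) ∈ ν.cells \ μ.cells ↔ μ.rowLen i ≤ j ∧ j < ν.rowLen i := by
  rw [Finset.mem_sdiff, YoungDiagram.mem_cells, YoungDiagram.mem_cells,
    YoungDiagram.mem_iff_lt_rowLen, YoungDiagram.mem_iff_lt_rowLen]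
  omega

theorem card_eq_sum_rowLen {μ : YoungDiagram} {n : ℕ} (hn : μ.colLen 0 ≤ n) :
    μ.cells.card = ∑ i : Fin n, μ.rowLen i := by
  rw [Finset.card_eq_sum_card_fiberwise (f := Prod.fst) (t := Finset.range n),
    Finset.sum_range]
  · exact Finset.sum_congr rfl fun i _ => (μ.rowLen_eq_card).symm
  · rintro ⟨i, j⟩ hc
    have h1 := YoungDiagram.mem_iff_lt_rowLen.1 ((YoungDiagram.mem_cells _).1 hc)
    rw [Finset.mem_coe, Finset.mem_range]
    by_contra! hni
    have := rowLen_eq_zero_iff.2 (hn.trans hni)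
    dsimp only at this
    omega

theorem card_sdiff_cells {μ ν : YoungDiagram} (hle : μ ≤ ν) {n : ℕ} (hn : ν.colLen 0 ≤ n) :
    ((ν.cells \ μ.cells).card : ℤ) = ∑ i : Fin n, (bead ν i - bead μ i) := by
  rw [Finset.card_sdiff_of_subset (YoungDiagram.cells_subset_iff.2 hle),
    Nat.cast_sub (Finset.card_le_card (YoungDiagram.cells_subset_iff.2 hle)),
    card_eq_sum_rowLen hn, card_eq_sum_rowLen ((colLen_mono hle).trans hn)]
  push_cast
  rw [← Finset.sum_sub_distrib]
  exact Finset.sum_congr rfl fun i _ => by unfold bead; ring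

/-! ### Border strips as moves of a single bead. -/

/-- `ν` arises from `μ` by adding a border strip with `t` cells that occupies the rows
`p, …, q`. -/
structure AddStrip (t : ℕ) (μ ν : YoungDiagram) (p q : ℕ) : Prop where
  le : p ≤ q
  rowLen_of_lt : ∀ i, i < p → ν.rowLen i = μ.rowLen i
  rowLen_of_gt : ∀ i, q < i → ν.rowLen i = μ.rowLen i
  rowLen_succ : ∀ i, p ≤ i → i < q → ν.rowLen (i + 1) = μ.rowLen i + 1
  rowLen_top : ν.rowLen p + q = μ.rowLen q + t + p

namespace AddStrip

variable {t p q : ℕ} {μ ν : YoungDiagram}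

theorem rowLen_lt (H : AddStrip t μ ν p q) (ht : 0 < t) {i : ℕ} (hp : p ≤ i) (hq : i ≤ q) :
    μ.rowLen i < ν.rowLen i := by
  rcases hp.eq_or_lt with rfl | hp
  · rcases hq.eq_or_lt with rfl | hq
    · have := H.rowLen_top
      omega
    · have h1 := H.rowLen_succ p le_rfl hq
      have h2 := ν.rowLen_anti p (p + 1) (Nat.le_succ p)
      omega
  · obtain ⟨i, rfl⟩ : ∃ k, i = k + 1 := ⟨i - 1, by omega⟩
    have h1 := H.rowLen_succ i (by omega) (by omega)
    have h2 := μ.rowLen_anti i (i + 1) (Nat.le_succ i)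
    omega

theorem rowLen_eq (H : AddStrip t μ ν p q) {i : ℕ} (hi : ¬ (p ≤ i ∧ i ≤ q)) :
    ν.rowLen i = μ.rowLen i := by
  rcases lt_or_ge i p with h1 | h1
  · exact H.rowLen_of_lt i h1
  · exact H.rowLen_of_gt i (by omega)

theorem shape_le (H : AddStrip t μ ν p q) (ht : 0 < t) : μ ≤ ν := by
  refine le_iff_rowLen_le.2 fun i => ?_
  by_cases hi : p ≤ i ∧ i ≤ q
  · exact (H.rowLen_lt ht hi.1 hi.2).le
  · exact (H.rowLen_eq hi).ge

theorem lt_colLen (H : AddStrip t μ ν p q) (ht : 0 < t) : q < ν.colLen 0 := by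
  by_contra! hq
  have := H.rowLen_lt ht H.le le_rfl
  rw [rowLen_eq_zero_iff.2 hq] at this
  omega

/-- In terms of beads, `rowLen_succ` says that beads `p, …, q - 1` stay in place while their index
grows by one, and `rowLen_top` says that bead `q` jumps `t` steps right and gets index `p`. The
index change is thus the cycle on `[p, q]`. -/
theorem bead_cycleIcc (H : AddStrip t μ ν p q) {n : ℕ} (hp : p < n) (hq : q < n) (i : Fin n) :
    bead ν (Fin.cycleIcc ⟨p, hp⟩ ⟨q, hq⟩ i) = bead μ i + if (i : ℕ) = q then (t : ℤ) else 0 := by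
  have : NeZero n := ⟨by omega⟩
  obtain ⟨i, hi⟩ := i
  have hle := H.le
  rcases lt_or_ge i p with h1 | h1
  · rw [Fin.cycleIcc_of_lt (by simpa using h1)]
    have := H.rowLen_of_lt i h1
    simp only [bead]
    rw [if_neg (by omega)]
    omega
  rcases lt_trichotomy i q with h2 | h2 | h2
  · rw [Fin.cycleIcc_of_ge_of_lt (by simpa using h1) (by simpa using h2)]
    have h3 := H.rowLen_succ i h1 h2
    have h4 : ((⟨i, hi⟩ + 1 : Fin n) : ℕ) = i + 1 := by
      rw [Fin.val_add_one_of_lt' (by simpa using by omega)]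
    rw [h4]
    simp only [bead]
    rw [if_neg (by omega)]
    omega
  · subst h2
    rw [Fin.cycleIcc_of_last (by simpa using h1)]
    have := H.rowLen_top
    simp only [bead, if_true]
    omega
  · rw [Fin.cycleIcc_of_gt (by simpa using h2)]
    have := H.rowLen_of_gt i h2
    simp only [bead]
    rw [if_neg (by omega)]
    omega

/-- The cell count is the total displacement of the beads; after reindexing by the cycle only bead
`q` contributes. Containment is assumed in place of `0 < t`, because the lemma later serves to
identify `t`. -/
theorem card_eq (H : AddStrip t μ ν p q) (hle : μ ≤ ν) : (ν.cells \ μ.cells).card = t := by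
  obtain ⟨n, hn, hqn⟩ : ∃ n, ν.colLen 0 ≤ n ∧ q < n :=
    ⟨max (ν.colLen 0) (q + 1), le_max_left _ _, by omega⟩
  have hpn : p < n := H.le.trans_lt hqn
  have h1 := card_sdiff_cells hle hn
  rw [Finset.sum_sub_distrib,
    ← Equiv.sum_comp (Fin.cycleIcc ⟨p, hpn⟩ ⟨q, hqn⟩) (fun i => bead ν (i : Fin n)),
    ← Finset.sum_sub_distrib, Finset.sum_eq_single ⟨q, hqn⟩] at h1
  · rw [H.bead_cycleIcc] at h1
    simpa using h1
  · intro i _ hi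
    rw [H.bead_cycleIcc, if_neg (fun h => hi (Fin.ext h))]
    ring
  · simp

theorem ribbonHeight_eq (H : AddStrip t μ ν p q) (ht : 0 < t) :
    ribbonHeight (ν.cells \ μ.cells) = q - p := by
  have : (ν.cells \ μ.cells).image Prod.fst = Finset.Icc p q := by
    ext i
    rw [Finset.mem_image, Finset.mem_Icc]
    constructor
    · rintro ⟨⟨i, j⟩, hc, rfl⟩
      rw [mem_sdiff_cells] at hc
      by_contra hi
      have := H.rowLen_eq hi
      dsimp only at this
      omega
    · intro hi
      exact ⟨(i, μ.rowLen i), mem_sdiff_cells.2 ⟨le_rfl, H.rowLen_lt ht hi.1 hi.2⟩, rfl⟩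
  have hle := H.le
  rw [ribbonHeight, this, Nat.card_Icc]
  omega

end AddStrip

/-! ### Ribbons and border strips are the same. -/

theorem hasse_adj_iff {i j k l : ℕ} :
    (SimpleGraph.hasse (ℕ × ℕ)).Adj (i, j) (k, l) ↔
      (i + 1 = k ∧ j = l ∨ j + 1 = l ∧ i = k) ∨ (k + 1 = i ∧ l = j ∨ l + 1 = j ∧ k = i) := by
  rw [SimpleGraph.hasse_adj, Prod.mk_covBy_mk_iff, Prod.mk_covBy_mk_iff,
    Nat.covBy_iff_add_one_eq, Nat.covBy_iff_add_one_eq, Nat.covBy_iff_add_one_eq,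
    Nat.covBy_iff_add_one_eq]

theorem AddStrip.isRibbon {t p q : ℕ} {μ ν : YoungDiagram} (H : AddStrip t μ ν p q)
    (ht : 0 < t) : IsRibbon t (ν.cells \ μ.cells) where
  card_eq := H.card_eq (H.shape_le ht)
  no_square := by
    rintro i j ⟨h1, -, h3, h4⟩
    rw [mem_sdiff_cells] at h1 h3 h4
    -- Consecutive rows `i`, `i + 1` of the strip share only the column `μ.rowLen i`.
    by_cases hi : p ≤ i ∧ i < q
    · have := H.rowLen_succ i hi.1 hi.2
      omega
    · by_cases h5 : i + 1 < p ∨ q < i + 1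
      · have := H.rowLen_eq (i := i + 1) (by omega)
        omega
      · have := H.rowLen_eq (i := i) (by omega)
        omega
  connected := by
    set S := ν.cells \ μ.cells with hS
    set G := (SimpleGraph.hasse (ℕ × ℕ)).induce (S : Set (ℕ × ℕ)) with hG
    have mem : ∀ {i j : ℕ}, μ.rowLen i ≤ j → j < ν.rowLen i → (i, j) ∈ (S : Set (ℕ × ℕ)) :=
      fun h1 h2 => Finset.mem_coe.2 (mem_sdiff_cells.2 ⟨h1, h2⟩)
    have row : ∀ (i j : ℕ) (h1 : μ.rowLen i ≤ j) (h2 : j < ν.rowLen i),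
        G.Reachable ⟨(i, μ.rowLen i), mem le_rfl (h1.trans_lt h2)⟩ ⟨(i, j), mem h1 h2⟩ := by
      intro i j h1
      induction j, h1 using Nat.le_induction with
      | base => exact fun _ => SimpleGraph.Reachable.refl _
      | succ j h1 ih =>
        intro h2
        refine (ih (by omega)).trans (SimpleGraph.Adj.reachable ?_)
        rw [hG, SimpleGraph.comap_adj]
        exact hasse_adj_iff.2 (by omega)
    -- The first cell of row `i` lies directly above the last cell of row `i + 1`, so first cells of
    -- successive rows are linked.
    have lead : ∀ (i : ℕ) (h1 : p ≤ i) (h2 : i ≤ q),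
        G.Reachable ⟨(p, μ.rowLen p), mem le_rfl (H.rowLen_lt ht le_rfl H.le)⟩
          ⟨(i, μ.rowLen i), mem le_rfl (H.rowLen_lt ht h1 h2)⟩ := by
      intro i h1
      induction i, h1 using Nat.le_induction with
      | base => exact fun _ => SimpleGraph.Reachable.refl _
      | succ i h1 ih =>
        intro h2
        have h3 := H.rowLen_succ i h1 h2
        have h4 := μ.rowLen_anti i (i + 1) (Nat.le_succ i)
        refine ((ih (by omega)).trans (SimpleGraph.Adj.reachable ?_)).trans
          (row (i + 1) (μ.rowLen i) h4 (by omega)).symm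
        rw [hG, SimpleGraph.comap_adj]
        exact hasse_adj_iff.2 (by omega)
    rw [SimpleGraph.connected_iff_exists_forall_reachable]
    refine ⟨⟨(p, μ.rowLen p), mem le_rfl (H.rowLen_lt ht le_rfl H.le)⟩, ?_⟩
    rintro ⟨⟨i, j⟩, hc⟩
    have hc' := mem_sdiff_cells.1 (Finset.mem_coe.1 hc)
    have hi : p ≤ i ∧ i ≤ q := by
      by_contra hi
      have := H.rowLen_eq hi
      omega
    exact (lead i hi.1 hi.2).trans (row i j hc'.1 hc'.2)

/-- A path from `c` to `d` must step from row `i` to row `i + 1` within one column, which then lies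
at or beyond `μ.rowLen i` and before `ν.rowLen (i + 1)`. If there is no such column, all cells
reachable from `c` stay in rows up to `i`. -/
theorem IsRibbon.rowLen_lt_of_connected {μ ν : YoungDiagram}
    (hconn : ((SimpleGraph.hasse (ℕ × ℕ)).induce
      ((ν.cells \ μ.cells : Finset (ℕ × ℕ)) : Set (ℕ × ℕ))).Connected)
    {c d : ℕ × ℕ} (hc : c ∈ ν.cells \ μ.cells) (hd : d ∈ ν.cells \ μ.cells) {i : ℕ}
    (hci : c.1 ≤ i) (hid : i < d.1) : μ.rowLen i < ν.rowLen (i + 1) := by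
  by_contra! hlt
  have key := hconn.preconnected ⟨c, Finset.mem_coe.2 hc⟩ ⟨d, Finset.mem_coe.2 hd⟩
  rw [SimpleGraph.reachable_iff_reflTransGen] at key
  have : ∀ e, Relation.ReflTransGen ((SimpleGraph.hasse (ℕ × ℕ)).induce
      ((ν.cells \ μ.cells : Finset (ℕ × ℕ)) : Set (ℕ × ℕ))).Adj ⟨c, Finset.mem_coe.2 hc⟩ e →
      e.1.1 ≤ i := by
    intro e he
    induction he with
    | refl => exact hci
    | @tail a b _ hab ih =>
      obtain ⟨⟨a1, a2⟩, ha⟩ := a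
      obtain ⟨⟨b1, b2⟩, hb⟩ := b
      rw [SimpleGraph.comap_adj] at hab
      replace hab := hasse_adj_iff.1 hab
      have ha' := mem_sdiff_cells.1 (Finset.mem_coe.1 ha)
      have hb' := mem_sdiff_cells.1 (Finset.mem_coe.1 hb)
      dsimp only at ih ⊢
      by_contra! hbi
      obtain ⟨rfl, rfl⟩ : b1 = i + 1 ∧ a1 = i := by omega
      omega
  exact absurd (this _ key) (by simpa using hid)

/-- A ribbon between two Young diagrams is a border strip. -/
theorem IsRibbon.exists_addStrip {t : ℕ} {μ ν : YoungDiagram} (hle : μ ≤ ν)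
    (hS : IsRibbon t (ν.cells \ μ.cells)) : ∃ p q, AddStrip t μ ν p q := by
  set S := ν.cells \ μ.cells with hSdef
  have hne : (S.image Prod.fst).Nonempty := by
    obtain ⟨c⟩ := hS.connected.nonempty
    exact ⟨_, Finset.mem_image_of_mem _ (Finset.mem_coe.1 c.2)⟩
  obtain ⟨c, hc, hcp⟩ := Finset.mem_image.1 (Finset.min'_mem _ hne)
  obtain ⟨d, hd, hdq⟩ := Finset.mem_image.1 (Finset.max'_mem _ hne)
  have hcd : c.1 ≤ d.1 := by
    rw [hcp]
    exact Finset.min'_le _ _ (Finset.mem_image_of_mem _ hd)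
  have hrow : ∀ i, ν.rowLen i ≠ μ.rowLen i → c.1 ≤ i ∧ i ≤ d.1 := by
    intro i hi
    have h1 := le_iff_rowLen_le.1 hle i
    have h2 : i ∈ S.image Prod.fst :=
      Finset.mem_image.2 ⟨(i, μ.rowLen i), mem_sdiff_cells.2 ⟨le_rfl, by omega⟩, rfl⟩
    rw [hcp, hdq]
    exact ⟨Finset.min'_le _ _ h2, Finset.le_max' _ _ h2⟩
  -- The size is first taken to be whatever `rowLen_top` demands; this equation says the truncated
  -- subtraction loses nothing. Counting cells identifies it with `t` at the end.
  have h1 : ν.rowLen c.1 + d.1 =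
      μ.rowLen d.1 + (ν.rowLen c.1 + d.1 - μ.rowLen d.1 - c.1) + c.1 := by
    have h2 := le_iff_rowLen_le.1 hle c.1
    have h3 := μ.rowLen_anti _ _ hcd
    omega
  have H : AddStrip (ν.rowLen c.1 + d.1 - μ.rowLen d.1 - c.1) μ ν c.1 d.1 := by
    refine ⟨hcd, fun i hi => ?_, fun i hi => ?_, fun i hi1 hi2 => ?_, h1⟩
    · by_contra hne
      have := hrow i hne
      omega
    · by_contra hne
      have := hrow i hne
      omega
    -- Connectedness gives the lower bound on row `i + 1`; exceeding it would create a square in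
    -- columns `μ.rowLen i` and `μ.rowLen i + 1`.
    · have h2 := IsRibbon.rowLen_lt_of_connected hS.connected hc hd hi1 hi2
      by_contra hne
      have h3 := ν.rowLen_anti i (i + 1) (Nat.le_succ i)
      have h4 := μ.rowLen_anti i (i + 1) (Nat.le_succ i)
      refine hS.no_square i (μ.rowLen i) ⟨?_, ?_, ?_, ?_⟩ <;>
        rw [hSdef, mem_sdiff_cells] <;> omega
  have h2 := H.card_eq hle
  rw [hS.card_eq] at h2
  rw [← h2] at H
  exact ⟨_, _, H⟩

/-! ### From ribbon decompositions to permutations of beads. -/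

/-- The permutation `σ` sends the first `n` beads of `μ` to those of `ν`, each bead moving a
nonnegative multiple of `t` to the right. -/
def MovesBeads (t n : ℕ) (μ ν : YoungDiagram) (σ : Equiv.Perm (Fin n)) : Prop :=
  ∀ i : Fin n, ∃ a : ℕ, bead ν (σ i) = bead μ i + t * a

/-- The permutation `σ` of the first `n` beads of `μ` is increasing on each runner. -/
def MonotoneOnRunners (t n : ℕ) (μ : YoungDiagram) (σ : Equiv.Perm (Fin n)) : Prop :=
  ∀ i j : Fin n, i < j → (t : ℤ) ∣ bead μ i - bead μ j → σ i < σ j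

namespace MovesBeads

variable {t n : ℕ} {μ ν κ : YoungDiagram} {σ τ : Equiv.Perm (Fin n)}

theorem refl (t n : ℕ) (μ : YoungDiagram) : MovesBeads t n μ μ 1 := fun _ => ⟨0, by simp⟩

theorem trans (hσ : MovesBeads t n μ ν σ) (hτ : MovesBeads t n ν κ τ) :
    MovesBeads t n μ κ (τ * σ) := by
  intro i
  obtain ⟨a, ha⟩ := hσ i
  obtain ⟨b, hb⟩ := hτ (σ i)
  refine ⟨a + b, ?_⟩
  rw [Equiv.Perm.mul_apply, hb, ha]
  push_cast
  ring

theorem dvd_sub_iff (hσ : MovesBeads t n μ ν σ) (i j : Fin n) :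
    (t : ℤ) ∣ bead ν (σ i) - bead ν (σ j) ↔ (t : ℤ) ∣ bead μ i - bead μ j := by
  obtain ⟨a, ha⟩ := hσ i
  obtain ⟨b, hb⟩ := hσ j
  have : bead ν (σ i) - bead ν (σ j) = bead μ i - bead μ j + t * (a - b) := by
    rw [ha, hb]; ring
  rw [this]
  exact dvd_add_left (dvd_mul_right _ _)

theorem emod_eq (hσ : MovesBeads t n μ ν σ) (i : Fin n) :
    bead ν (σ i) % (t : ℤ) = bead μ i % (t : ℤ) := by
  obtain ⟨a, ha⟩ := hσ i
  rw [ha, Int.add_mul_emod_self_left]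

theorem monotoneOnRunners_trans (hσ : MovesBeads t n μ ν σ) (mσ : MonotoneOnRunners t n μ σ)
    (mτ : MonotoneOnRunners t n ν τ) : MonotoneOnRunners t n μ (τ * σ) :=
  fun i j hij hd => mτ _ _ (mσ i j hij hd) ((hσ.dvd_sub_iff i j).2 hd)

theorem sum_sub_eq (σ : Equiv.Perm (Fin n)) (μ ν : YoungDiagram) :
    ∑ i : Fin n, (bead ν i - bead μ i) = ∑ i : Fin n, (bead ν (σ i) - bead μ i) := by
  rw [Finset.sum_sub_distrib, Finset.sum_sub_distrib,
    Equiv.sum_comp σ (fun i => bead ν (i : Fin n))]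

end MovesBeads

theorem AddStrip.exists_movesBeads {t p q n : ℕ} {μ ν : YoungDiagram} (H : AddStrip t μ ν p q)
    (ht : 0 < t) (hn : ν.colLen 0 ≤ n) :
    ∃ σ : Equiv.Perm (Fin n), MovesBeads t n μ ν σ ∧ MonotoneOnRunners t n μ σ ∧
      (Equiv.Perm.sign σ : ℤ) = (-1) ^ ribbonHeight (ν.cells \ μ.cells) ∧
      ∀ i : Fin n, bead ν (σ i) = bead μ i + if (i : ℕ) = q then (t : ℤ) else 0 := by
  have hq : q < n := (H.lt_colLen ht).trans_le hn
  have hp : p < n := H.le.trans_lt hq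
  have key := H.bead_cycleIcc hp hq
  refine ⟨_, fun i => ?_, fun i j hij hd => ?_, ?_, key⟩
  · rw [key]
    split_ifs
    · exact ⟨1, by simp⟩
    · exact ⟨0, by simp⟩
  · by_contra! hji
    have h1 : bead μ j < bead μ i := bead_strictAnti μ hij
    -- Beads on one runner are at least `t` apart, so a single jump by `t` cannot overtake.
    have h2 : bead μ j + t ≤ bead μ i := by
      have := Int.le_of_dvd (by omega) hd
      omega
    have hne := fun h => hij.ne' ((Fin.cycleIcc ⟨p, hp⟩ ⟨q, hq⟩).injective h)
    have h3 := bead_strictAnti ν (show ((Fin.cycleIcc ⟨p, hp⟩ ⟨q, hq⟩ j : Fin n) : ℕ) <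
      (Fin.cycleIcc ⟨p, hp⟩ ⟨q, hq⟩ i : Fin n) from lt_of_le_of_ne hji (Fin.val_ne_of_ne hne))
    rw [key, key] at h3
    split_ifs at h3 <;> omega
  · rw [Fin.sign_cycleIcc_of_le (by simpa using H.le), H.ribbonHeight_eq ht]
    simp

/-- Stated for a bare chain of shapes so that the induction can remove the last ribbon. The bound
`n` stays fixed because smaller shapes have no more rows. -/
theorem exists_movesBeads_of_chain {t n : ℕ} (ht : 0 < t) (L : ℕ)
    (shape : Fin (L + 1) → YoungDiagram)
    (hle : ∀ r : Fin L, shape r.castSucc ≤ shape r.succ)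
    (hrib : ∀ r : Fin L, IsRibbon t ((shape r.succ).cells \ (shape r.castSucc).cells))
    (hn : (shape (Fin.last L)).colLen 0 ≤ n) :
    ∃ σ : Equiv.Perm (Fin n), MovesBeads t n (shape 0) (shape (Fin.last L)) σ ∧
      MonotoneOnRunners t n (shape 0) σ ∧ (Equiv.Perm.sign σ : ℤ) =
        (-1) ^ ∑ r : Fin L, ribbonHeight ((shape r.succ).cells \ (shape r.castSucc).cells) := by
  induction L with
  | zero => exact ⟨1, MovesBeads.refl t n _, fun i j hij _ => hij, by simp⟩
  | succ L ih =>
    have h1 := hle (Fin.last L)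
    obtain ⟨p, q, H⟩ := IsRibbon.exists_addStrip h1 (hrib (Fin.last L))
    rw [Fin.succ_last] at h1 H
    obtain ⟨τ, hτ, mτ, sτ, -⟩ := H.exists_movesBeads ht hn
    obtain ⟨σ, hσ, mσ, sσ⟩ := ih (fun r => shape r.castSucc)
      (fun r => by simpa only [Fin.succ_castSucc] using hle r.castSucc)
      (fun r => by simpa only [Fin.succ_castSucc] using hrib r.castSucc)
      ((colLen_mono h1).trans hn)
    refine ⟨τ * σ, hσ.trans hτ, hσ.monotoneOnRunners_trans mσ mτ, ?_⟩
    rw [Fin.sum_univ_castSucc, pow_add, Equiv.Perm.sign_mul, Units.val_mul, sσ, sτ, mul_comm]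
    rfl

theorem RibbonDecomposition.exists_movesBeads {t n : ℕ} (ht : 0 < t) {lam mu : YoungDiagram}
    (D : RibbonDecomposition t lam mu) (hn : lam.colLen 0 ≤ n) :
    ∃ σ : Equiv.Perm (Fin n), MovesBeads t n mu lam σ ∧ MonotoneOnRunners t n mu σ ∧
      ((Equiv.Perm.sign σ : ℤ) : ℚ) = D.sign := by
  obtain ⟨σ, h1, h2, h3⟩ := exists_movesBeads_of_chain (n := n) ht D.length D.shape D.shape_le
    D.isRibbon (by rw [D.shape_last]; exact hn)
  rw [D.shape_zero, D.shape_last] at h1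
  rw [D.shape_zero] at h2
  refine ⟨σ, h1, h2, ?_⟩
  rw [h3, RibbonDecomposition.sign]
  push_cast
  rfl

/-! ### From permutations of beads to ribbon decompositions. -/

/-- The Young diagram whose rows have the prescribed lengths. -/
def ofRowLen (f : ℕ → ℕ) (hf : Antitone f) (n : ℕ) : YoungDiagram where
  cells := (Finset.range n ×ˢ Finset.range (f 0)).filter fun c => c.2 < f c.1
  isLowerSet := by
    rintro ⟨i2, j2⟩ ⟨i1, j1⟩ ⟨hi : i1 ≤ i2, hj : j1 ≤ j2⟩ hc
    simp only [Finset.coe_filter, Finset.mem_product, Finset.mem_range, Set.mem_ofPred_eq] at hc ⊢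
    have := hf hi
    omega

theorem rowLen_ofRowLen {f : ℕ → ℕ} (hf : Antitone f) {n : ℕ} (hn : ∀ i, n ≤ i → f i = 0)
    (i : ℕ) : (ofRowLen f hf n).rowLen i = f i := by
  refine eq_of_forall_lt_iff fun j => ?_
  rw [← YoungDiagram.mem_iff_lt_rowLen]
  change (i, j) ∈ Finset.filter _ _ ↔ _
  rw [Finset.mem_filter, Finset.mem_product, Finset.mem_range, Finset.mem_range]
  have h1 := hf (Nat.zero_le i)
  have h2 := hn i
  dsimp only
  omega

/-- Bead `q` can jump to a free position; sorting the beads again produces the rows of `ν`, with `p`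
the index at which the moved bead is inserted. -/
theorem exists_addStrip {t n q : ℕ} {μ : YoungDiagram} (ht : 0 < t) (hn : μ.colLen 0 ≤ n)
    (hq : q < n) (hfree : ∀ j, bead μ j ≠ bead μ q + t) :
    ∃ (ν : YoungDiagram) (p : ℕ), AddStrip t μ ν p q ∧ ν.colLen 0 ≤ n := by
  classical
  have hex : ∃ p, bead μ p < bead μ q + t := ⟨q, by omega⟩
  obtain ⟨p, hp, hmin⟩ : ∃ p, bead μ p < bead μ q + t ∧ ∀ i, i < p → bead μ q + t < bead μ i :=
    ⟨Nat.find hex, Nat.find_spec hex, fun i hi =>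
      lt_of_le_of_ne (not_lt.1 (Nat.find_min hex hi)) (hfree i).symm⟩
  have hpq : p ≤ q := by
    by_contra! hlt
    have := hmin q hlt
    omega
  -- The subtraction of `q` does not truncate, since `bead μ p < bead μ q + t`; `i - 1` is read only
  -- when `i > p`.
  let f : ℕ → ℕ := fun i => if i < p ∨ q < i then μ.rowLen i else
    if i = p then μ.rowLen q + t + p - q else μ.rowLen (i - 1) + 1
  unfold bead at hp hmin
  have hf : Antitone f := by
    refine antitone_nat_of_succ_le fun i => ?_
    have h1 := μ.rowLen_anti i (i + 1) (Nat.le_succ i)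
    have h2 := μ.rowLen_anti (i - 1) i (Nat.sub_le i 1)
    have h3 := hmin i
    simp only [f, Nat.add_sub_cancel]
    by_cases hip : i = p
    · subst hip
      by_cases hiq : i = q
      · subst hiq
        simp
        omega
      · split_ifs <;> omega
    · by_cases hiq : i = q
      · subst hiq
        split_ifs <;> omega
      · split_ifs <;> omega
  have hf0 : ∀ i, n ≤ i → f i = 0 := by
    intro i hi
    simp only [f]
    rw [if_pos (by omega), rowLen_eq_zero_iff]
    omega
  refine ⟨ofRowLen f hf n, p, ⟨hpq, fun i hi => ?_, fun i hi => ?_, fun i h1 h2 => ?_, ?_⟩, ?_⟩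
  · rw [rowLen_ofRowLen hf hf0]
    exact if_pos (Or.inl hi)
  · rw [rowLen_ofRowLen hf hf0]
    exact if_pos (Or.inr hi)
  · rw [rowLen_ofRowLen hf hf0]
    simp only [f]
    rw [if_neg (by omega), if_neg (by omega), Nat.add_sub_cancel]
  · rw [rowLen_ofRowLen hf hf0]
    simp only [f]
    rw [if_neg (by omega), if_pos trivial]
    omega
  · rw [← rowLen_eq_zero_iff, rowLen_ofRowLen hf hf0]
    exact hf0 n le_rfl

/-- If some bead has to move, then the targets can be rearranged so that some bead that has to move
has a free position `t` steps to its right. -/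
theorem MovesBeads.exists_free {t n : ℕ} {μ ν : YoungDiagram} (ht : 0 < t) (i : Fin n) :
    ∀ σ : Equiv.Perm (Fin n), MovesBeads t n μ ν σ → bead ν (σ i) ≠ bead μ i →
    ∃ (τ : Equiv.Perm (Fin n)) (q : Fin n), MovesBeads t n μ ν τ ∧ bead ν (τ q) ≠ bead μ q ∧
      ∀ j, bead μ j ≠ bead μ q + t := by
  induction i using WellFoundedLT.induction with
  | _ i ih =>
    intro σ hσ hi
    by_cases hfree : ∀ j, bead μ j ≠ bead μ i + t
    · exact ⟨σ, i, hσ, hi, hfree⟩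
    push Not at hfree
    obtain ⟨j, hj⟩ := hfree
    have hji : j < i := (bead_strictAnti μ).lt_iff_gt.1 (by omega)
    obtain ⟨j, rfl⟩ : ∃ k : Fin n, (k : ℕ) = j := ⟨⟨j, hji.trans i.2⟩, rfl⟩
    by_cases hσj : bead ν (σ j) = bead μ j
    · have hne : bead ν (σ i) ≠ bead μ j := by
        rw [← hσj]
        intro h
        have := σ.injective (Fin.ext ((bead_strictAnti ν).injective h))
        exact hji.ne (congrArg Fin.val this.symm)
      -- The position in front of bead `i` is held by bead `j`, which is already at its target.
      -- Exchanging targets lets `i` move exactly one step and passes the remaining steps to `j`,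
      -- which now has to move. The index has dropped, so this ends.
      refine ih j hji (σ * Equiv.swap i j) (fun k => ?_) ?_
      · rcases eq_or_ne k i with rfl | hki
        · exact ⟨1, by simp [hσj, hj]⟩
        · rcases eq_or_ne k j with rfl | hkj
          · obtain ⟨a, ha⟩ := hσ i
            rw [Equiv.Perm.mul_apply, Equiv.swap_apply_right]
            match a, ha with
            | 0, ha => exact absurd (by simpa using ha) hi
            | a + 1, ha =>
              refine ⟨a, ?_⟩
              rw [ha, hj]
              push_cast
              ring
          · rw [Equiv.Perm.mul_apply, Equiv.swap_apply_of_ne_of_ne hki hkj]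
            exact hσ k
      · rwa [Equiv.Perm.mul_apply, Equiv.swap_apply_right]
    · exact ih j hji σ hσ hσj

/-- Prepending a ribbon to a ribbon decomposition. -/
def RibbonDecomposition.cons {t : ℕ} {lam mu nu : YoungDiagram}
    (D : RibbonDecomposition t lam nu) (hle : mu ≤ nu) (hrib : IsRibbon t (nu.cells \ mu.cells)) :
    RibbonDecomposition t lam mu where
  length := D.length + 1
  shape := Fin.cons mu D.shape
  shape_zero := rfl
  shape_last := by
    rw [← Fin.succ_last, Fin.cons_succ, D.shape_last]
  shape_le := by
    refine Fin.cases ?_ fun r => ?_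
    · simpa [D.shape_zero] using hle
    · simpa [← Fin.succ_castSucc] using D.shape_le r
  isRibbon := by
    refine Fin.cases ?_ fun r => ?_
    · simpa [D.shape_zero] using hrib
    · simpa [← Fin.succ_castSucc] using D.isRibbon r

/-- Beads are listed in decreasing order, so `σ` is strictly increasing and hence the identity. -/
theorem eq_of_forall_bead_eq {n : ℕ} {μ ν : YoungDiagram} (hμ : μ.colLen 0 ≤ n)
    (hν : ν.colLen 0 ≤ n) {σ : Equiv.Perm (Fin n)} (hσ : ∀ i, bead ν (σ i) = bead μ i) :
    ν = μ := by
  have hmono : StrictMono σ := by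
    intro i j hij
    have h1 := bead_strictAnti μ hij
    rw [← hσ, ← hσ] at h1
    exact (bead_strictAnti ν).lt_iff_gt.1 h1
  have hid : (σ : Fin n → Fin n) = id :=
    (hmono.range_inj strictMono_id).1 (by rw [σ.surjective.range_eq, Set.range_id])
  refine eq_of_rowLen_eq fun i => ?_
  rcases lt_or_ge i n with hi | hi
  · have := hσ ⟨i, hi⟩
    rw [hid] at this
    simp only [bead, id] at this
    omega
  · rw [rowLen_eq_zero_iff.2 (hμ.trans hi), rowLen_eq_zero_iff.2 (hν.trans hi)]

/-- Induction on the total displacement: as long as some bead has to move, one can be moved `t`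
steps, which adds a ribbon to `μ` and lowers the displacement by `t`. -/
theorem MovesBeads.isTileable {t n : ℕ} {ν : YoungDiagram} (ht : 0 < t) (hν : ν.colLen 0 ≤ n)
    {μ : YoungDiagram} (hμ : μ.colLen 0 ≤ n) {σ : Equiv.Perm (Fin n)}
    (hσ : MovesBeads t n μ ν σ) : IsTileable t ν μ := by
  induction hN : (∑ i : Fin n, (bead ν i - bead μ i)).toNat using Nat.strong_induction_on
    generalizing μ σ with
  | _ N ih =>
    by_cases hall : ∀ i, bead ν (σ i) = bead μ i
    · obtain rfl := eq_of_forall_bead_eq hμ hν hall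
      exact ⟨⟨0, fun _ => ν, rfl, rfl, fun r => r.elim0, fun r => r.elim0⟩⟩
    push Not at hall
    obtain ⟨i, hi⟩ := hall
    obtain ⟨σ, q, hσ, hq, hfree⟩ := MovesBeads.exists_free ht i σ hσ hi
    obtain ⟨κ, p, H, hκ⟩ := SymFun.exists_addStrip ht hμ q.2 hfree
    obtain ⟨τ, -, -, -, hτ⟩ := H.exists_movesBeads ht hκ
    have hmove : MovesBeads t n κ ν (σ * τ⁻¹) := by
      intro j
      obtain ⟨k, rfl⟩ := τ.surjective j
      obtain ⟨a, ha⟩ := hσ k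
      rw [Equiv.Perm.mul_apply, Equiv.Perm.inv_def, Equiv.symm_apply_apply, hτ, ha]
      split_ifs with hk
      · obtain rfl := Fin.ext hk
        match a, ha with
        | 0, ha => exact absurd (by simpa using ha) hq
        | a + 1, ha =>
          refine ⟨a, ?_⟩
          push_cast
          ring
      · exact ⟨a, by ring⟩
    have hsum : ∑ i : Fin n, (bead κ i - bead μ i) = t := by
      rw [MovesBeads.sum_sub_eq τ, Finset.sum_eq_single q]
      · simp [hτ]
      · intro i _ hi
        rw [hτ, if_neg (fun h => hi (Fin.ext h))]
        ring
      · simp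
    have hnonneg : 0 ≤ ∑ i : Fin n, (bead ν i - bead κ i) := by
      rw [MovesBeads.sum_sub_eq (σ * τ⁻¹)]
      refine Finset.sum_nonneg fun i _ => ?_
      obtain ⟨a, ha⟩ := hmove i
      rw [ha]
      have : (0 : ℤ) ≤ t * a := by positivity
      linarith
    have hsplit : ∑ i : Fin n, (bead ν i - bead μ i) =
        ∑ i : Fin n, (bead ν i - bead κ i) + ∑ i : Fin n, (bead κ i - bead μ i) := by
      rw [← Finset.sum_add_distrib]
      exact Finset.sum_congr rfl fun i _ => by ring
    obtain ⟨D⟩ := ih _ (by omega) hκ hmove rfl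
    exact ⟨D.cons (H.shape_le ht) (H.isRibbon ht)⟩

/-! ### Beads on a runner and the rows of the quotient. -/

/-- The `i`-th bead of `lam` lies on runner `r`. -/
abbrev OnRunner (t r : ℕ) (lam : YoungDiagram) (i : ℕ) : Prop := bead lam i % (t : ℤ) = r

/-- Far to the left every position is a bead. Infinitude makes `Nat.nth` and `Nat.count` invert each
other along the runner. -/
theorem infinite_onRunner {t r : ℕ} (hr : r < t) (lam : YoungDiagram) :
    (Set.ofPred (OnRunner t r lam)).Infinite := by
  refine Set.infinite_of_forall_exists_gt fun a => ?_
  have hle : a + lam.colLen 0 + 2 ≤ t * (a + lam.colLen 0 + 2) :=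
    Nat.le_mul_of_pos_left _ (by omega)
  have hle2 : t + (a + lam.colLen 0 + 1) ≤ t * (a + lam.colLen 0 + 2) := by nlinarith
  -- Row `tN - 1 - r` is empty for this large `N`, so its bead sits at `r - tN`.
  refine ⟨t * (a + lam.colLen 0 + 2) - 1 - r, ?_, by omega⟩
  change bead lam _ % (t : ℤ) = r
  rw [bead_of_colLen_le (by omega)]
  have : (-(((t * (a + lam.colLen 0 + 2) - 1 - r : ℕ) : ℤ) + 1)) =
      r + t * (-((a + lam.colLen 0 + 2 : ℕ) : ℤ)) := by
    rw [Nat.cast_sub (by omega), Nat.cast_sub (by omega)]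
    push_cast
    ring
  rw [this, Int.add_mul_emod_self_left]
  exact Int.emod_eq_of_lt (by positivity) (by exact_mod_cast hr)

theorem filter_range_eq_map_nth (p : ℕ → Prop) [DecidablePred p] (n : ℕ) :
    (List.range n).filter p = (List.range (Nat.count p n)).map (Nat.nth p) := by
  induction n with
  | zero => simp
  | succ n ih =>
    rw [List.range_succ, List.filter_append, ih, Nat.count_succ]
    by_cases hp : p n
    · simp [hp, List.range_succ, Nat.nth_count hp]
    · simp [hp]

theorem rowLen_ofRowLens (w : List ℕ) (hw : w.SortedGE) (i : ℕ) :
    (YoungDiagram.ofRowLens w hw).rowLen i = w.getD i 0 := by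
  refine eq_of_forall_lt_iff fun j => ?_
  rw [← YoungDiagram.mem_iff_lt_rowLen, YoungDiagram.mem_ofRowLens]
  by_cases hi : i < w.length
  · simp [hi]
  · simp [hi]

theorem emptyLeft_eq_zero (t r : ℕ) {lam : YoungDiagram} {i : ℕ} (hi : lam.colLen 0 ≤ i) :
    emptyLeft t r lam (bead lam i) = 0 := by
  have : {e : ℤ | e < bead lam i ∧ e % (t : ℤ) = (r : ℤ) ∧ e ∉ Set.range (bead lam)} = ∅ := by
    refine Set.eq_empty_of_forall_notMem fun e he => he.2.2 ⟨(-e - 1).toNat, ?_⟩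
    have h1 := he.1
    rw [bead_of_colLen_le hi] at h1
    rw [bead_of_colLen_le (by omega)]
    omega
  rw [emptyLeft, this, Set.ncard_empty]

theorem rowLen_quotient {t r : ℕ} (hr : r < t) (lam : YoungDiagram) (k : ℕ) :
    (quotient t r lam).rowLen k =
      emptyLeft t r lam (bead lam (Nat.nth (OnRunner t r lam) k)) := by
  rw [quotient, rowLen_ofRowLens]
  have := filter_range_eq_map_nth (OnRunner t r lam) (lam.colLen 0)
  rw [this, List.map_map]
  rcases lt_or_ge k (Nat.count (OnRunner t r lam) (lam.colLen 0)) with hk | hk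
  · simp [hk]
  · rw [List.getD_eq_default _ _ (by simpa using hk)]
    exact (emptyLeft_eq_zero t r
      ((Nat.count_le_iff_le_nth (infinite_onRunner hr lam)).1 hk)).symm

theorem rowLen_quotient_eq_zero {t r n k : ℕ} (hr : r < t) {lam : YoungDiagram}
    (hn : lam.colLen 0 ≤ n) (hk : Nat.count (OnRunner t r lam) n ≤ k) :
    (quotient t r lam).rowLen k = 0 := by
  rw [rowLen_quotient hr]
  exact emptyLeft_eq_zero t r
    (hn.trans ((Nat.count_le_iff_le_nth (infinite_onRunner hr lam)).1 hk))

theorem card_filter_Ico_emod {t r n : ℕ} (ht : 0 < t) {b : ℤ} (hb : b % (t : ℤ) = r)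
    (hbn : -(n : ℤ) ≤ b) :
    (((Finset.Ico (-(n : ℤ)) b).filter fun e => e % (t : ℤ) = r).card : ℤ) = (b + n) / t := by
  have h1 := Int.Ico_filter_modEq_card (-(n : ℤ)) b (r := t) (by exact_mod_cast ht) b
  have h2 : ((Finset.Ico (-(n : ℤ)) b).filter fun e => e % (t : ℤ) = r) =
      (Finset.Ico (-(n : ℤ)) b).filter fun e => e ≡ b [ZMOD t] := by
    refine Finset.filter_congr fun e _ => ?_
    rw [Int.ModEq, hb]
  rw [h2, h1]
  have h3 : ((-(n : ℤ) : ℤ) - (b : ℚ)) / ((t : ℤ) : ℚ) = -(((b + n : ℤ) : ℚ) / ((t : ℤ) : ℚ)) := by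
    push_cast
    ring
  rw [h3, Int.ceil_neg, sub_self, zero_div, Int.ceil_zero, zero_sub, neg_neg,
    Int.cast_natCast, Rat.floor_intCast_div_natCast]
  exact max_eq_left (Int.ediv_nonneg (by omega) (by omega))

/-- Each row of a component of the quotient, in terms of the position of the corresponding bead. -/
theorem emptyLeft_add_count {t r n i : ℕ} (ht : 0 < t) {lam : YoungDiagram}
    (hn : lam.colLen 0 ≤ n) (hi : i < n) (hri : OnRunner t r lam i) :
    (emptyLeft t r lam (bead lam i) : ℤ) + Nat.count (OnRunner t r lam) n =
      (bead lam i + n) / t + Nat.count (OnRunner t r lam) (i + 1) := by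
  classical
  -- All positions below `-n` are beads, and the beads from `-n` on are exactly the first `n`. Hence
  -- the runner positions in `[-n, bead lam i)` split into the empty ones counted by `emptyLeft` and
  -- the beads with index in `(i, n)`.
  have hlow : ∀ j, j < n ↔ -(n : ℤ) ≤ bead lam j := by
    intro j
    constructor
    · intro hj
      unfold bead
      omega
    · intro hj
      by_contra! hnj
      rw [bead_of_colLen_le (hn.trans hnj)] at hj
      omega
  rw [← card_filter_Ico_emod ht hri ((hlow i).1 hi)]
  norm_cast
  rw [← Finset.card_filter_add_card_filter_not (s := (Finset.Ico (-(n : ℤ)) (bead lam i)).filter _)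
    (fun e => e ∈ Set.range (bead lam))]
  have h1 : emptyLeft t r lam (bead lam i) =
      (((Finset.Ico (-(n : ℤ)) (bead lam i)).filter fun e => e % (t : ℤ) = r).filter
        fun e => e ∉ Set.range (bead lam)).card := by
    rw [emptyLeft, ← Set.ncard_coe_finset]
    congr 1
    ext e
    simp only [Finset.coe_filter, Finset.mem_filter, Finset.mem_Ico, Set.mem_ofPred_eq]
    refine ⟨fun he => ⟨⟨⟨?_, he.1⟩, he.2.1⟩, he.2.2⟩, fun he => ⟨he.1.1.2, he.1.2, he.2⟩⟩
    by_contra! hlt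
    refine he.2.2 ⟨(-e - 1).toNat, ?_⟩
    rw [bead_of_colLen_le (by omega)]
    omega
  have h2 : (((Finset.Ico (-(n : ℤ)) (bead lam i)).filter fun e => e % (t : ℤ) = r).filter
        fun e => e ∈ Set.range (bead lam)).card =
      (((Finset.range n).filter (OnRunner t r lam)).filter fun j => ¬ j < i + 1).card := by
    refine (Finset.card_nbij (bead lam) ?_ (bead_strictAnti lam).injective.injOn ?_).symm
    · intro j hj
      simp only [Finset.coe_filter, Finset.mem_filter, Finset.mem_range, Set.mem_ofPred_eq,
        Finset.mem_Ico] at hj ⊢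
      exact ⟨⟨⟨(hlow j).1 hj.1.1, bead_strictAnti lam (by omega)⟩, hj.1.2⟩, j, rfl⟩
    · intro e he
      simp only [Finset.coe_filter, Finset.mem_filter, Finset.mem_Ico, Set.mem_ofPred_eq] at he
      obtain ⟨⟨⟨h3, h4⟩, h5⟩, j, rfl⟩ := he
      refine ⟨j, ?_, rfl⟩
      simp only [Finset.coe_filter, Finset.mem_filter, Finset.mem_range, Set.mem_ofPred_eq]
      have := (bead_strictAnti lam).lt_iff_gt.1 h4
      exact ⟨⟨(hlow j).2 h3, h5⟩, by omega⟩
  have h3 : Nat.count (OnRunner t r lam) (i + 1) =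
      (((Finset.range n).filter (OnRunner t r lam)).filter fun j => j < i + 1).card := by
    rw [Nat.count_eq_card_filter_range]
    congr 1
    ext j
    simp only [Finset.mem_filter, Finset.mem_range]
    constructor
    · exact fun h => ⟨⟨by omega, h.2⟩, h.1⟩
    · exact fun h => ⟨h.2, h.1.2⟩
  have h4 := Finset.card_filter_add_card_filter_not (s := (Finset.range n).filter (OnRunner t r lam))
    (fun j => j < i + 1)
  rw [← Nat.count_eq_card_filter_range] at h4
  omega

/-- Indexing by rank on the runner prepares the comparison of two shapes: with equally many beads on
the runner, the constant `1 - count n` cancels, and the ranks absorb the `-i + j` of Jacobi–Trudi.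
-/
theorem rowLen_quotient_count {t r n i : ℕ} (hr : r < t) {lam : YoungDiagram}
    (hn : lam.colLen 0 ≤ n) (hi : i < n) (hri : OnRunner t r lam i) :
    ((quotient t r lam).rowLen (Nat.count (OnRunner t r lam) i) : ℤ) =
      (bead lam i + n) / t + Nat.count (OnRunner t r lam) i + 1 -
        Nat.count (OnRunner t r lam) n := by
  have := emptyLeft_add_count (by omega) hn hi hri
  rw [Nat.count_succ, if_pos hri] at this
  rw [rowLen_quotient hr, Nat.nth_count hri]
  push_cast at this
  linarith

theorem card_fin_filter_eq_count (p : ℕ → Prop) [DecidablePred p] {n m : ℕ} (hm : m ≤ n) :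
    (Finset.univ.filter fun j : Fin n => (j : ℕ) < m ∧ p j).card = Nat.count p m := by
  rw [Nat.count_eq_card_filter_range]
  refine Finset.card_nbij (fun j => (j : ℕ)) ?_ Fin.val_injective.injOn ?_
  · intro j hj
    simpa using hj
  · intro j hj
    have hj' : j < m ∧ p j := by simpa using hj
    exact ⟨⟨j, by omega⟩, by simpa using hj', rfl⟩

namespace MovesBeads

variable {t n r : ℕ} {μ ν : YoungDiagram} {σ : Equiv.Perm (Fin n)}

theorem onRunner_iff (hσ : MovesBeads t n μ ν σ) (i : Fin n) :
    OnRunner t r ν (σ i) ↔ OnRunner t r μ i := by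
  rw [OnRunner, hσ.emod_eq i]

theorem count_eq (hσ : MovesBeads t n μ ν σ) :
    Nat.count (OnRunner t r ν) n = Nat.count (OnRunner t r μ) n := by
  rw [← card_fin_filter_eq_count _ le_rfl, ← card_fin_filter_eq_count _ le_rfl]
  refine (Finset.card_equiv σ fun i => ?_).symm
  simp [hσ.onRunner_iff]

/-- An order-preserving bijection between the beads of a runner preserves ranks. -/
theorem count_apply_eq (hσ : MovesBeads t n μ ν σ) (mσ : MonotoneOnRunners t n μ σ) {i : Fin n}
    (hi : OnRunner t r μ i) :
    Nat.count (OnRunner t r ν) (σ i) = Nat.count (OnRunner t r μ) i := by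
  rw [← card_fin_filter_eq_count _ i.2.le, ← card_fin_filter_eq_count _ (σ i).2.le]
  refine (Finset.card_equiv σ fun j => ?_).symm
  simp only [Finset.mem_filter, Finset.mem_univ, true_and, hσ.onRunner_iff, Fin.val_fin_lt]
  refine and_congr_left fun hj => ?_
  have hd : (t : ℤ) ∣ bead μ i - bead μ j :=
    Int.ModEq.dvd (show bead μ j % (t : ℤ) = bead μ i % t by rw [hi, hj])
  rcases lt_trichotomy i j with h | rfl | h
  · exact iff_of_false h.asymm (mσ i j h hd).asymm
  · simp
  · exact iff_of_true h (mσ j i h (by rwa [← dvd_neg, neg_sub]))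

theorem quotient_le (hσ : MovesBeads t n μ ν σ) (mσ : MonotoneOnRunners t n μ σ) (hr : r < t)
    (hμ : μ.colLen 0 ≤ n) (hν : ν.colLen 0 ≤ n) : quotient t r μ ≤ quotient t r ν := by
  refine le_iff_rowLen_le.2 fun k => ?_
  rcases lt_or_ge k (Nat.count (OnRunner t r μ) n) with hk | hk
  · obtain ⟨i, hi, rfl⟩ : ∃ i : Fin n, OnRunner t r μ i ∧ Nat.count (OnRunner t r μ) i = k :=
      ⟨⟨_, Nat.nth_lt_of_lt_count hk⟩, Nat.nth_mem_of_infinite (infinite_onRunner hr μ) k,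
        Nat.count_nth_of_infinite (infinite_onRunner hr μ) k⟩
    have h1 := rowLen_quotient_count hr hμ i.2 hi
    have h2 := rowLen_quotient_count hr hν (σ i).2 ((hσ.onRunner_iff i).2 hi)
    rw [hσ.count_apply_eq mσ hi, hσ.count_eq] at h2
    obtain ⟨a, ha⟩ := hσ i
    have h3 : (bead μ i + n) / (t : ℤ) ≤ (bead ν (σ i) + n) / t := by
      refine Int.ediv_le_ediv (by omega) ?_
      rw [ha]
      have : (0 : ℤ) ≤ t * a := by positivity
      linarith
    omega
  · rw [rowLen_quotient_eq_zero hr hμ hk]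
    exact Nat.zero_le _

end MovesBeads

/-! ### Determinants: Jacobi–Trudi and its image under the Verschiebung. -/

/-- The Jacobi–Trudi matrix of `lam/mu` of size `n`. -/
def jacobiTrudi (n : ℕ) (lam mu : YoungDiagram) : Matrix (Fin n) (Fin n) Lambda :=
  Matrix.of fun i j => hInt ((lam.rowLen i : ℤ) - mu.rowLen j - i + j)

theorem hInt_zero : hInt 0 = 1 := by
  simp [hInt, h_zero]

theorem hInt_of_neg {k : ℤ} (hk : k < 0) : hInt k = 0 := if_neg hk.not_ge

theorem det_eq_det_submatrix_of_last_row {R : Type*} [CommRing R] {n : ℕ}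
    (M : Matrix (Fin (n + 1)) (Fin (n + 1)) R) (hone : M (Fin.last n) (Fin.last n) = 1)
    (hzero : ∀ j : Fin n, M (Fin.last n) j.castSucc = 0) :
    M.det = (M.submatrix (Fin.last n).succAbove (Fin.last n).succAbove).det := by
  rw [Matrix.det_succ_row _ (Fin.last n), Fin.sum_univ_castSucc]
  simp [hone, hzero]

/-- The Jacobi–Trudi determinant of `lam/mu` may be computed with any number of rows that is at least
the number of parts of `lam`. -/
theorem det_jacobiTrudi {lam mu : YoungDiagram} (hle : mu ≤ lam) {n : ℕ}
    (hn : lam.colLen 0 ≤ n) : (jacobiTrudi n lam mu).det = skewSchur lam mu := by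
  induction n, hn using Nat.le_induction with
  | base => rfl
  | succ n hn ih =>
    -- Both shapes are empty in row `n`, so the added last row is `(0, …, 0, 1)`.
    have hlam : lam.rowLen n = 0 := rowLen_eq_zero_iff.2 hn
    have hmu : mu.rowLen n = 0 := rowLen_eq_zero_iff.2 ((colLen_mono hle).trans hn)
    have h1 : (jacobiTrudi (n + 1) lam mu).submatrix (Fin.last n).succAbove
        (Fin.last n).succAbove = jacobiTrudi n lam mu := by
      ext i j
      simp [jacobiTrudi]
    rw [det_eq_det_submatrix_of_last_row _ ?_ fun j => ?_, h1, ih]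
    · rw [jacobiTrudi, Matrix.of_apply, ← hInt_zero]
      congr 1
      simp [hlam, hmu]
    · refine hInt_of_neg ?_
      have := j.2
      rw [Fin.val_last, hlam, Fin.val_castSucc]
      push_cast
      omega

/-- The entrywise image of the Jacobi–Trudi matrix under the Verschiebung, in terms of beads. -/
def beadMatrix (t n : ℕ) (lam mu : YoungDiagram) : Matrix (Fin n) (Fin n) Lambda :=
  Matrix.of fun i j => if (t : ℤ) ∣ bead lam i - bead mu j then
    hInt ((bead lam i - bead mu j) / t) else 0

theorem verschiebung_skewSchur {t : ℕ} (ht : t ≠ 0) (lam mu : YoungDiagram) :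
    verschiebung t ht (skewSchur lam mu) = (beadMatrix t (lam.colLen 0) lam mu).det := by
  rw [verschiebung_eq_verschiebungHom, AlgHom.toLinearMap_apply, skewSchur, AlgHom.map_det]
  congr 1
  ext1 i j
  rw [AlgHom.mapMatrix_apply, Matrix.map_apply, Matrix.of_apply, verschiebungHom_hInt ht,
    beadMatrix, Matrix.of_apply]
  have : (lam.rowLen i : ℤ) - mu.rowLen j - i + j = bead lam i - bead mu j := by
    unfold bead
    ring
  rw [this]

/-- Some Leibniz term is nonzero; each of its factors forces divisibility by `t` and, as `h_k = 0`
for `k < 0`, a move to the right. -/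
theorem exists_movesBeads_of_det_ne_zero {t n : ℕ} (ht : 0 < t) {lam mu : YoungDiagram}
    (hdet : (beadMatrix t n lam mu).det ≠ 0) :
    ∃ σ : Equiv.Perm (Fin n), MovesBeads t n mu lam σ := by
  rw [Matrix.det_apply'] at hdet
  obtain ⟨σ, -, hσ⟩ := Finset.exists_ne_zero_of_sum_ne_zero hdet
  refine ⟨σ, fun i => ?_⟩
  have hi : beadMatrix t n lam mu (σ i) i ≠ 0 := fun h0 =>
    hσ (by
    rw [Finset.prod_eq_zero (f := fun j => beadMatrix t n lam mu (σ j) j) (Finset.mem_univ i) h0,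
      mul_zero])
  rw [beadMatrix, Matrix.of_apply] at hi
  obtain ⟨⟨k, hk⟩, hne⟩ := ite_ne_right_iff.1 hi
  rw [hk, Int.mul_ediv_cancel_left _ (by omega)] at hne
  have hk0 : 0 ≤ k := by
    by_contra! hlt
    exact hne (hInt_of_neg hlt)
  lift k to ℕ using hk0
  exact ⟨k, by linarith⟩

theorem det_eq_sign_smul_det_submatrix {R ι : Type*} [CommRing R] [Algebra ℚ R] [Fintype ι]
    [DecidableEq ι] (σ : Equiv.Perm ι) (M : Matrix ι ι R) :
    M.det = ((Equiv.Perm.sign σ : ℤ) : ℚ) • (M.submatrix σ id).det := by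
  rw [Matrix.det_permute]
  rcases Int.units_eq_one_or (Equiv.Perm.sign σ) with h | h <;> simp [h]

/-- The indices of the first `n` beads on a runner, enumerated in increasing order. -/
def runnerEquiv {t r : ℕ} (hr : r < t) (n : ℕ) (mu : YoungDiagram) :
    {i : Fin n // OnRunner t r mu i} ≃ Fin (Nat.count (OnRunner t r mu) n) where
  toFun i := ⟨Nat.count (OnRunner t r mu) i, Nat.count_strict_mono i.2 i.1.2⟩
  invFun k := ⟨⟨Nat.nth (OnRunner t r mu) k, Nat.nth_lt_of_lt_count k.2⟩,
    Nat.nth_mem_of_infinite (infinite_onRunner hr mu) k⟩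
  left_inv i := Subtype.ext (Fin.ext (Nat.nth_count i.2))
  right_inv k := Fin.ext (Nat.count_nth_of_infinite (infinite_onRunner hr mu) k)

theorem MovesBeads.beadMatrix_apply {t n r : ℕ} (hr : r < t) {lam mu : YoungDiagram}
    (hlam : lam.colLen 0 ≤ n) (hmu : mu.colLen 0 ≤ n) {σ : Equiv.Perm (Fin n)}
    (hσ : MovesBeads t n mu lam σ) (mσ : MonotoneOnRunners t n mu σ)
    {i j : Fin n} (hi : OnRunner t r mu i) (hj : OnRunner t r mu j) :
    beadMatrix t n lam mu (σ i) j =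
      hInt (((quotient t r lam).rowLen (Nat.count (OnRunner t r mu) i) : ℤ) -
        (quotient t r mu).rowLen (Nat.count (OnRunner t r mu) j) -
        Nat.count (OnRunner t r mu) i + Nat.count (OnRunner t r mu) j) := by
  have hσi := (hσ.onRunner_iff i).2 hi
  have h1 := rowLen_quotient_count hr hmu j.2 hj
  have h2 := rowLen_quotient_count hr hlam (σ i).2 hσi
  rw [hσ.count_apply_eq mσ hi, hσ.count_eq] at h2
  obtain ⟨k, hk⟩ : (t : ℤ) ∣ bead lam (σ i) - bead mu j :=
    Int.ModEq.dvd (show bead mu j % (t : ℤ) = bead lam (σ i) % t by rw [hσi, hj])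
  have ht : (t : ℤ) ≠ 0 := by omega
  rw [beadMatrix, Matrix.of_apply, if_pos ⟨k, hk⟩, hk, Int.mul_ediv_cancel_left _ ht]
  have h3 : bead lam (σ i) + n = bead mu j + n + t * k := by linarith
  rw [h3, Int.add_mul_ediv_left _ _ ht] at h2
  congr 1
  linarith

/-- Entries joining different runners vanish. On runner `r`, listing beads by rank turns the block
into a Jacobi–Trudi matrix of the quotients, possibly with more rows than `λ^(r)` has parts. -/
theorem MovesBeads.det_beadMatrix {t n : ℕ} (ht : 0 < t) {lam mu : YoungDiagram}
    (hlam : lam.colLen 0 ≤ n) (hmu : mu.colLen 0 ≤ n) {σ : Equiv.Perm (Fin n)}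
    (hσ : MovesBeads t n mu lam σ) (mσ : MonotoneOnRunners t n mu σ) :
    ((beadMatrix t n lam mu).submatrix σ id).det =
      ∏ r ∈ Finset.range t, skewSchur (quotient t r lam) (quotient t r mu) := by
  let b : Fin n → Fin t := fun i => ⟨(bead mu i % (t : ℤ)).toNat, by
    have := Int.emod_lt_of_pos (bead mu i) (show (0 : ℤ) < t by exact_mod_cast ht)
    omega⟩
  have hb : ∀ i k, b i = k ↔ OnRunner t k mu i := by
    intro i k
    have := Int.emod_nonneg (bead mu i) (show (t : ℤ) ≠ 0 by omega)
    rw [Fin.ext_iff]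
    change (bead mu i % (t : ℤ)).toNat = (k : ℕ) ↔ bead mu i % (t : ℤ) = ((k : ℕ) : ℤ)
    omega
  have htri : ((beadMatrix t n lam mu).submatrix σ id).BlockTriangular b := by
    intro i j hij
    refine if_neg fun hd => hij.ne ((hb j (b i)).2 ?_)
    rw [OnRunner, ← (hb i (b i)).1 rfl, ← hσ.emod_eq i]
    exact Int.modEq_iff_dvd.2 hd
  rw [htri.det_fintype, Finset.prod_range]
  refine Finset.prod_congr rfl fun r _ => ?_
  have hcol : (quotient t r lam).colLen 0 ≤ Nat.count (OnRunner t r mu) n := by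
    rw [← rowLen_eq_zero_iff]
    exact rowLen_quotient_eq_zero r.2 hlam hσ.count_eq.le
  rw [← det_jacobiTrudi (hσ.quotient_le mσ r.2 hmu hlam) hcol,
    ← Matrix.det_submatrix_equiv_self
      ((Equiv.subtypeEquivRight fun i => hb i r).trans (runnerEquiv r.2 n mu))]
  congr 1
  ext1 i j
  exact hσ.beadMatrix_apply r.2 hlam hmu mσ ((hb _ _).1 i.2) ((hb _ _).1 j.2)

end SymFun

end

/-! ### The theorem, using the first `l(λ)` beads of both shapes. -/

theorem theorem3p1 (t : ℕ) (ht : 2 ≤ t) (lam mu : YoungDiagram) (hle : mu ≤ lam) :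
    (¬ SymFun.IsTileable t lam mu →
      SymFun.verschiebung t (Nat.ne_zero_of_lt ht) (SymFun.skewSchur lam mu) = 0) ∧
    ∀ D : SymFun.RibbonDecomposition t lam mu,
      SymFun.verschiebung t (Nat.ne_zero_of_lt ht) (SymFun.skewSchur lam mu) =
        D.sign • ∏ r ∈ Finset.range t,
          SymFun.skewSchur (SymFun.quotient t r lam) (SymFun.quotient t r mu) := by
  have htpos : 0 < t := by omega
  have hmu := SymFun.colLen_mono hle
  rw [SymFun.verschiebung_skewSchur]
  constructor
  · intro hnot
    by_contra hdet
    obtain ⟨σ, hσ⟩ := SymFun.exists_movesBeads_of_det_ne_zero htpos hdet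
    exact hnot (hσ.isTileable htpos le_rfl hmu)
  · intro D
    obtain ⟨σ, hσ, mσ, hsign⟩ := D.exists_movesBeads htpos le_rfl
    rw [← hσ.det_beadMatrix htpos le_rfl hmu mσ, ← hsign]
    exact SymFun.det_eq_sign_smul_det_submatrix σ _
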